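/- Let $T_k$ be the Chebyshev polynomial of the first kind of degree $k$. For a continuous function $f$ on $[-1,1]$ put $$a_k=\frac{2}{\pi}\int_{-1}^{1}\frac{f(x)T_k(x)}{\sqrt{1-x^2}}\,dx ,\qquad f_n(x)=\frac{a_0}{2}+\sum_{k=1}^{n}a_kT_k(x),$$ so that $f_n$ is the Chebyshev projection of $f$ of degree $n$. Let $\alpha>1$. There is an integer $m\ge 0$, depending only on $\alpha$, such that the following holds for every $\xi\in[-1,1]$ and every real-valued $g\in C^m([-1,1])$, where $f(x)=|x-\xi|^{\alpha}g(x)$. (i) If $\xi\in(-1,1)$ and $\alpha$ is not an even integer, then $f\in C^1([-1,1])$ and, as $n\to\infty$, $$|f'(x)-f_n'(x)|=\begin{cases}O(n^{-\alpha}), & \text{for each } x\in(-1,1),\\ O(n^{1-\alpha}), & x=\pm1,\end{cases}\qquad \max_{x\in[-1,1]}|f'(x)-f_n'(x)|=O(n^{1-\alpha}).$$ (ii) If $\xi=\pm1$ and $\alpha$ is not an integer, then $f\in C^1([-1,1])$ and, as $n\to\infty$, $$|f'(x)-f_n'(x)|=\begin{cases}O(n^{-2\alpha}), & \text{for each } x\in(-1,1),\\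 O(n^{1-2\alpha}), & x=-\xi,\\ O(n^{2-2\alpha}), & x=\xi,\end{cases}\qquad \max_{x\in[-1,1]}|f'(x)-f_n'(x)|=O(n^{2-2\alpha}).$$ The derivatives of $f$ at $\pm1$ are one-sided. The constants implied in the pointwise estimates may depend on $x$, $\xi$, $\alpha$ and $g$; those in the maximum-norm estimates may depend on $\xi$, $\alpha$ and $g$. -/

import Mathlib

open Set Filter Polynomial

/-- The model function `x ↦ |x - ξ| ^ α * g x` with an algebraic singularity at `ξ`. -/
noncomputable def modelFun (ξ α : ℝ) (g : ℝ → ℝ) (x : ℝ) : ℝ :=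
  |x - ξ| ^ α * g x

/-- The `k`-th Chebyshev coefficient `(2 / π) ∫_{-1}^{1} f x * T_k x / √(1 - x²) dx`. -/
noncomputable def chebCoeff (f : ℝ → ℝ) (k : ℕ) : ℝ :=
  (2 / Real.pi) * ∫ x in (-1 : ℝ)..1, f x * (Chebyshev.T ℝ (k : ℤ)).eval x / Real.sqrt (1 - x ^ 2)

/-- The Chebyshev projection of degree `n`: the Chebyshev series of `f`, whose term of index `0`
is halved, truncated after the term of index `n`. -/
noncomputable def chebProj (f : ℝ → ℝ) (n : ℕ) : ℝ[X] :=
  ∑ k ∈ Finset.range (n + 1),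
    C ((if k = 0 then 1 / 2 else 1) * chebCoeff f k) * Chebyshev.T ℝ (k : ℤ)

/-- The error `f' x - f_n' x` of Chebyshev spectral differentiation on `[-1, 1]`; at `x = ±1` the
derivative of `f` is the one-sided one. -/
noncomputable def chebDiffError (f : ℝ → ℝ) (n : ℕ) (x : ℝ) : ℝ :=
  derivWithin f (Icc (-1) 1) x - (derivative (chebProj f n)).eval x

/-- The maximum norm on `[-1, 1]` (of a function that is bounded there). -/
noncomputable def maxNorm (h : ℝ → ℝ) : ℝ :=
  sSup ((fun x => |h x|) '' Icc (-1) 1)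

/-! With `x = cos θ` the `a_k` become Fourier cosine coefficients of `F θ = f (cos θ)`. This
function is singular only where `cos θ = ξ`: to order `α` at two points of the circle if `ξ` is
interior, to order `2α` at one point if `ξ = ±1`, because `cos θ - ξ` then has a double zero. On the
arcs between singular points `F` is a symbol (`ArcSymbol`), and `ArcSymbol.abs_integral_mul_cos_le`
gives `a_k = O(k ^ (-ρ - 1))` with `ρ = α` or `ρ = 2α`.

If `T_k' = O(k ^ p)`, summing the tail of the differentiated series bounds the error by `n ^ (p -
ρ)`, with `p = 2` on `[-1, 1]` and `p = 1` on compact subsets of the interior. This settles the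
maximum norm for `ξ = ±1` and a neighbourhood of an interior `ξ`; elsewhere a factor `n` is missing,
and for small `ρ` the series with `p = 2` need not even converge absolutely.

The missing factor comes from multiplying by `x - ξ`. The coefficients of `(x - ξ) f` decay one
order faster, and since `x T_k = (T_{k+1} + T_{k-1}) / 2`, the polynomial `(x - ξ) f_n` is the
projection of `(x - ξ) f` up to two terms at the cutoff (`sub_mul_chebProj`). Hence `(x - ξ)` times
the error is `O(n ^ (p - 1 - ρ))` (`abs_sub_mul_chebDiffError_le`), which suffices wherever `x - ξ`
is bounded away from zero.

At an interior `ξ = cos a` itself, the error is the tail of `∑ k a_k sin (k a) / sin a`, and up to a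
constant the `a_k sin (k a)` are the sine coefficients of `F (a + t) - F (a - t)`. At `t = 0` the
difference gains one order. The reflected singularities at `t = ±2a` are removed by a power of `cos
t - cos (2a)`, which is nonzero at `t = 0`; summation by parts (`TailDecay.of_recurrence`) transfers
the tail estimate back. This is `abs_chebDiffError_singularity_le`. -/

/-- Symbols of order `γ` on the arc `(a, b)`, with control of `N` derivatives: the `j`-th derivative
is `O(d ^ (γ - j))`, where `d x = (x - a) * (b - x)`. -/
def ArcSymbol (a b : ℝ) : ℕ → ℝ → (ℝ → ℝ) → Prop
  | 0, γ, u => ContinuousOn u (Ioo a b) ∧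
      ∃ K, ∀ x ∈ Ioo a b, |u x| ≤ K * ((x - a) * (b - x)) ^ γ
  | N + 1, γ, u => (∃ K, ∀ x ∈ Ioo a b, |u x| ≤ K * ((x - a) * (b - x)) ^ γ) ∧
      ∃ v : ℝ → ℝ, (∀ x ∈ Ioo a b, HasDerivAt u (v x) x) ∧ ArcSymbol a b N (γ - 1) v

/-! ### Calculus of symbols on an arc -/

namespace ArcSymbol

variable {a b γ δ : ℝ} {N : ℕ} {u v : ℝ → ℝ}

lemma weight_pos {x : ℝ} (hx : x ∈ Ioo a b) : 0 < (x - a) * (b - x) :=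
  mul_pos (sub_pos.2 hx.1) (sub_pos.2 hx.2)

lemma bound (h : ArcSymbol a b N γ u) :
    ∃ K, 0 ≤ K ∧ ∀ x ∈ Ioo a b, |u x| ≤ K * ((x - a) * (b - x)) ^ γ := by
  have : ∃ K, ∀ x ∈ Ioo a b, |u x| ≤ K * ((x - a) * (b - x)) ^ γ := by
    cases N with
    | zero => exact h.2
    | succ N => exact h.1
  obtain ⟨K, hK⟩ := this
  refine ⟨|K|, abs_nonneg K, fun x hx => (hK x hx).trans ?_⟩
  have := (Real.rpow_pos_of_pos (weight_pos hx) γ).le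
  gcongr
  exact le_abs_self K

lemma continuousOn (h : ArcSymbol a b N γ u) : ContinuousOn u (Ioo a b) := by
  cases N with
  | zero => exact h.1
  | succ N =>
    obtain ⟨-, v, hv, -⟩ := h
    exact fun x hx => (hv x hx).continuousAt.continuousWithinAt

lemma congr (h : ArcSymbol a b N γ u) (huv : EqOn v u (Ioo a b)) : ArcSymbol a b N γ v := by
  cases N with
  | zero =>
    obtain ⟨hc, K, hK⟩ := h
    exact ⟨hc.congr huv, K, fun x hx => by rw [huv hx]; exact hK x hx⟩
  | succ N =>
    obtain ⟨⟨K, hK⟩, w, hw, hs⟩ := h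
    refine ⟨⟨K, fun x hx => by rw [huv hx]; exact hK x hx⟩, w, fun x hx => ?_, hs⟩
    exact (hw x hx).congr_of_eventuallyEq (huv.eventuallyEq_of_mem (Ioo_mem_nhds hx.1 hx.2))

lemma weaken_order (h : ArcSymbol a b N γ u) (hδ : δ ≤ γ) : ArcSymbol a b N δ u := by
  have key : ∀ {γ δ : ℝ} {u : ℝ → ℝ}, δ ≤ γ →
      (∃ K, 0 ≤ K ∧ ∀ x ∈ Ioo a b, |u x| ≤ K * ((x - a) * (b - x)) ^ γ) →
      ∃ K, ∀ x ∈ Ioo a b, |u x| ≤ K * ((x - a) * (b - x)) ^ δ := by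
    intro γ δ u hδ ⟨K, hK0, hK⟩
    refine ⟨K * ((b - a) * (b - a)) ^ (γ - δ), fun x hx => (hK x hx).trans ?_⟩
    have hp := weight_pos hx
    have e : ((x - a) * (b - x)) ^ γ = ((x - a) * (b - x)) ^ (γ - δ) * ((x - a) * (b - x)) ^ δ := by
      rw [← Real.rpow_add hp]; ring_nf
    rw [e, ← mul_assoc]
    have h1 : (x - a) * (b - x) ≤ (b - a) * (b - a) :=
      mul_le_mul (by linarith [hx.2]) (by linarith [hx.1]) (by linarith [hx.2])
        (by linarith [hx.1, hx.2])
    have h2 := (Real.rpow_pos_of_pos hp δ).le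
    have h3 := Real.rpow_le_rpow hp.le h1 (sub_nonneg.2 hδ)
    gcongr
  induction N generalizing γ δ u with
  | zero => exact ⟨h.1, key hδ h.bound⟩
  | succ N ih =>
    have hb := h.bound
    obtain ⟨-, w, hw, hs⟩ := h
    exact ⟨key hδ hb, w, hw, ih hs (by linarith)⟩

lemma of_succ (h : ArcSymbol a b (N + 1) γ u) : ArcSymbol a b N γ u := by
  induction N generalizing γ u with
  | zero =>
    obtain ⟨K, -, hK⟩ := h.bound
    exact ⟨h.continuousOn, K, hK⟩
  | succ N ih =>
    obtain ⟨hb, w, hw, hs⟩ := h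
    exact ⟨hb, w, hw, ih hs⟩

lemma add (hu : ArcSymbol a b N γ u) (hv : ArcSymbol a b N γ v) :
    ArcSymbol a b N γ (fun x => u x + v x) := by
  have key : ∃ K, ∀ x ∈ Ioo a b, |u x + v x| ≤ K * ((x - a) * (b - x)) ^ γ := by
    obtain ⟨K, -, hK⟩ := hu.bound
    obtain ⟨L, -, hL⟩ := hv.bound
    refine ⟨K + L, fun x hx => (abs_add_le _ _).trans ?_⟩
    rw [add_mul]
    exact add_le_add (hK x hx) (hL x hx)
  induction N generalizing γ u v with
  | zero => exact ⟨hu.1.add hv.1, key⟩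
  | succ N ih =>
    obtain ⟨-, u', hu', hus⟩ := hu
    obtain ⟨-, v', hv', hvs⟩ := hv
    refine ⟨key, fun x => u' x + v' x, fun x hx => (hu' x hx).add (hv' x hx), ih hus hvs ?_⟩
    obtain ⟨K, -, hK⟩ := hus.bound
    obtain ⟨L, -, hL⟩ := hvs.bound
    refine ⟨K + L, fun x hx => (abs_add_le _ _).trans ?_⟩
    rw [add_mul]
    exact add_le_add (hK x hx) (hL x hx)

lemma mul (hu : ArcSymbol a b N γ u) (hv : ArcSymbol a b N δ v) :
    ArcSymbol a b N (γ + δ) (fun x => u x * v x) := by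
  have key : ∃ K, ∀ x ∈ Ioo a b, |u x * v x| ≤ K * ((x - a) * (b - x)) ^ (γ + δ) := by
    obtain ⟨K, hK0, hK⟩ := hu.bound
    obtain ⟨L, hL0, hL⟩ := hv.bound
    refine ⟨K * L, fun x hx => ?_⟩
    have hp := weight_pos hx
    rw [abs_mul, Real.rpow_add hp, mul_mul_mul_comm]
    exact mul_le_mul (hK x hx) (hL x hx) (abs_nonneg _)
      (mul_nonneg hK0 (Real.rpow_pos_of_pos hp γ).le)
  induction N generalizing γ δ u v with
  | zero => exact ⟨hu.1.mul hv.1, key⟩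
  | succ N ih =>
    have hu0 := hu.of_succ
    have hv0 := hv.of_succ
    obtain ⟨-, u', hu', hus⟩ := hu
    obtain ⟨-, v', hv', hvs⟩ := hv
    have key' : ∀ {γ δ : ℝ} {u v : ℝ → ℝ}, ArcSymbol a b N γ u → ArcSymbol a b N δ v →
        ArcSymbol a b N (γ + δ) (fun x => u x * v x) := by
      intro γ δ u v hu hv
      refine ih hu hv ?_
      obtain ⟨K, hK0, hK⟩ := hu.bound
      obtain ⟨L, hL0, hL⟩ := hv.bound
      refine ⟨K * L, fun x hx => ?_⟩
      have hp := weight_pos hx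
      rw [abs_mul, Real.rpow_add hp, mul_mul_mul_comm]
      exact mul_le_mul (hK x hx) (hL x hx) (abs_nonneg _)
        (mul_nonneg hK0 (Real.rpow_pos_of_pos hp γ).le)
    refine ⟨key, fun x => u' x * v x + u x * v' x,
      fun x hx => (hu' x hx).mul (hv' x hx), add ?_ ?_⟩
    · convert key' hus hv0 using 1; ring
    · convert key' hu0 hvs using 1; ring

/-- All derivatives are bounded on the compact arc, which is stronger than the negative orders
demanded of them. -/
lemma of_contDiff (hu : ContDiff ℝ N u) : ArcSymbol a b N 0 u := by
  have key : ∀ {u : ℝ → ℝ}, Continuous u →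
      ∃ K, ∀ x ∈ Ioo a b, |u x| ≤ K * ((x - a) * (b - x)) ^ (0 : ℝ) := by
    intro u hu
    obtain ⟨K, hK⟩ := (isCompact_Icc (a := a) (b := b)).exists_bound_of_continuousOn hu.continuousOn
    exact ⟨K, fun x hx => by simpa using hK x (Ioo_subset_Icc_self hx)⟩
  induction N generalizing u with
  | zero => exact ⟨hu.continuous.continuousOn, key hu.continuous⟩
  | succ N ih =>
    refine ⟨key hu.continuous, deriv u, fun x _ => ?_, (ih ?_).weaken_order (by norm_num)⟩
    · exact (hu.differentiable (by simp) x).hasDerivAt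
    · exact (contDiff_succ_iff_deriv.1 (by exact_mod_cast hu)).2.2

lemma const_mul (c : ℝ) (hu : ArcSymbol a b N γ u) : ArcSymbol a b N γ (fun x => c * u x) := by
  have := (of_contDiff (a := a) (b := b) (N := N) (contDiff_const (c := c))).mul hu
  rwa [zero_add] at this

lemma of_contDiff_of_vanish (hu : ContDiff ℝ (N + 1 : ℕ) u) (ha : u a = 0) (hb : u b = 0) :
    ArcSymbol a b (N + 1) 1 u := by
  rcases le_or_gt b a with hab | hab
  · refine ⟨⟨0, fun x hx => absurd (hx.1.trans hx.2) hab.not_gt⟩, deriv u, fun x _ => ?_, ?_⟩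
    · exact (hu.differentiable (by simp) x).hasDerivAt
    · rw [sub_self]
      exact of_contDiff (contDiff_succ_iff_deriv.1 (by exact_mod_cast hu)).2.2
  have hd : ContDiff ℝ N (deriv u) := (contDiff_succ_iff_deriv.1 (by exact_mod_cast hu)).2.2
  refine ⟨?_, deriv u, fun x _ => (hu.differentiable (by simp) x).hasDerivAt, ?_⟩
  · obtain ⟨K, hK⟩ := (isCompact_Icc (a := a) (b := b)).exists_bound_of_continuousOn
      hd.continuous.continuousOn
    have hK0 : 0 ≤ K := (norm_nonneg _).trans (hK a (left_mem_Icc.2 hab.le))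
    have lip : ∀ x ∈ Icc a b, ∀ y ∈ Icc a b, |u y - u x| ≤ K * |y - x| := fun x hx y hy =>
      (convex_Icc a b).norm_image_sub_le_of_norm_deriv_le
        (fun z _ => hu.differentiable (by simp) z) hK hx hy
    -- The bounds `K (x - a)` and `K (b - x)`, multiplied by the opposite distances and added, give
    -- `(b - a) |u x| ≤ 2 K (x - a) (b - x)`.
    refine ⟨2 * K / (b - a), fun x hx => ?_⟩
    have hx' := Ioo_subset_Icc_self hx
    have h1 := lip a (left_mem_Icc.2 hab.le) x hx'
    have h2 := lip b (right_mem_Icc.2 hab.le) x hx'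
    rw [ha, sub_zero, abs_of_pos (a := x - a) (sub_pos.2 hx.1)] at h1
    rw [hb, sub_zero, abs_of_neg (a := x - b) (sub_neg.2 hx.2)] at h2
    have hx1 := sub_pos.2 hx.1
    have hx2 := sub_pos.2 hx.2
    rw [Real.rpow_one, div_mul_eq_mul_div, le_div_iff₀ (sub_pos.2 hab)]
    nlinarith [mul_le_mul_of_nonneg_left h1 hx2.le, mul_le_mul_of_nonneg_left h2 hx1.le]
  · rw [sub_self]; exact of_contDiff hd

/-- The derivative is `γ w' w ^ (γ - 1)`, so induction on `N` works only with `γ` left free.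
Exponents eventually become negative, which is where the lower bound on `w` enters. -/
lemma rpow {w : ℝ → ℝ} {c : ℝ} (hw : ArcSymbol a b N 1 w) (hc : 0 < c)
    (hwc : ∀ x ∈ Ioo a b, c * ((x - a) * (b - x)) ≤ w x) (γ : ℝ) :
    ArcSymbol a b N γ (fun x => w x ^ γ) := by
  have hpos : ∀ x ∈ Ioo a b, 0 < w x := fun x hx =>
    (mul_pos hc (weight_pos hx)).trans_le (hwc x hx)
  have key : ∀ γ : ℝ, ∃ K, ∀ x ∈ Ioo a b, |w x ^ γ| ≤ K * ((x - a) * (b - x)) ^ γ := by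
    intro γ
    rcases le_total 0 γ with h | h
    · obtain ⟨K, hK0, hK⟩ := hw.bound
      refine ⟨K ^ γ, fun x hx => ?_⟩
      rw [abs_of_pos (Real.rpow_pos_of_pos (hpos x hx) γ),
        ← Real.mul_rpow hK0 (weight_pos hx).le]
      refine Real.rpow_le_rpow (hpos x hx).le ?_ h
      simpa using (le_abs_self _).trans (hK x hx)
    · refine ⟨c ^ γ, fun x hx => ?_⟩
      rw [abs_of_pos (Real.rpow_pos_of_pos (hpos x hx) γ), ← Real.mul_rpow hc.le (weight_pos hx).le]
      exact Real.rpow_le_rpow_of_nonpos (mul_pos hc (weight_pos hx)) (hwc x hx) h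
  induction N generalizing γ with
  | zero =>
    exact ⟨hw.continuousOn.rpow_const fun x hx => Or.inl (hpos x hx).ne', key γ⟩
  | succ N ih =>
    have h0 := hw.of_succ
    obtain ⟨-, w', hw', hs⟩ := hw
    refine ⟨key γ, fun x => γ * (w' x * w x ^ (γ - 1)), fun x hx => ?_, ?_⟩
    · convert (hw' x hx).rpow_const (p := γ) (Or.inl (hpos x hx).ne') using 1
      ring
    · refine const_mul γ ?_
      convert hs.mul (ih h0 (γ - 1)) using 1
      ring

end ArcSymbol

/-! ### Oscillatory integrals of symbols -/

namespace ArcSymbol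

/-- Below order `-1` the integral is dominated by its cut-off ends, at distance of order `1 / κ`,
each contributing a multiple of `κ ^ (-γ - 1)`. -/
lemma integral_weight_rpow_le {a b : ℝ} (hab : a < b) {γ : ℝ} (hγ : γ + 1 < 0) {κ : ℝ}
    (hκ : 1 ≤ κ) {v : ℝ → ℝ} {K : ℝ} (hK0 : 0 ≤ K)
    (hK : ∀ x ∈ Ioo a b, |v x| ≤ K * ((x - a) * (b - x)) ^ γ) :
    |∫ x in (a + (b - a) / (4 * κ))..(b - (b - a) / (4 * κ)), v x| ≤
      K * (((b - a) / 2) ^ γ * (2 * (((b - a) / 4) ^ (γ + 1) / -(γ + 1)))) * κ ^ (-γ - 1) := by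
  have hL : 0 < b - a := sub_pos.2 hab
  have hκ0 : 0 < κ := by linarith
  set h := (b - a) / (4 * κ) with hh
  have hh0 : 0 < h := by positivity
  have hh4 : h ≤ (b - a) / 4 := by
    rw [hh]; gcongr; linarith
  have hle : a + h ≤ b - h := by linarith
  have i1 : ∫ x in (a + h)..(b - h), (x - a) ^ γ =
      ((b - a - h) ^ (γ + 1) - h ^ (γ + 1)) / (γ + 1) := by
    rw [intervalIntegral.integral_comp_sub_right (fun y => y ^ γ), integral_rpow]
    · congr 3 <;> ring
    · refine Or.inr ⟨by linarith, notMem_uIcc_of_lt ?_ ?_⟩ <;> linarith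
  have i2 : ∫ x in (a + h)..(b - h), (b - x) ^ γ =
      ((b - a - h) ^ (γ + 1) - h ^ (γ + 1)) / (γ + 1) := by
    rw [intervalIntegral.integral_comp_sub_left (fun y => y ^ γ), integral_rpow]
    · congr 3 <;> ring
    · refine Or.inr ⟨by linarith, notMem_uIcc_of_lt ?_ ?_⟩ <;> linarith
  have n1 : IntervalIntegrable (fun x => (x - a) ^ γ) MeasureTheory.volume (a + h) (b - h) := by
    refine ContinuousOn.intervalIntegrable (ContinuousOn.rpow_const (by fun_prop) fun x hx => ?_)
    rw [uIcc_of_le hle] at hx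
    left; linarith [hx.1]
  have n2 : IntervalIntegrable (fun x => (b - x) ^ γ) MeasureTheory.volume (a + h) (b - h) := by
    refine ContinuousOn.intervalIntegrable (ContinuousOn.rpow_const (by fun_prop) fun x hx => ?_)
    rw [uIcc_of_le hle] at hx
    left; linarith [hx.2]
  have hb : ∀ x ∈ Ioc (a + h) (b - h),
      ‖v x‖ ≤ K * (((b - a) / 2) ^ γ * ((x - a) ^ γ + (b - x) ^ γ)) := by
    intro x hx
    have h1 : 0 < x - a := by linarith [hx.1]
    have h2 : 0 < b - x := by linarith [hx.2]
    refine (hK x ⟨by linarith, by linarith⟩).trans ?_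
    gcongr
    have q1 := Real.rpow_pos_of_pos h1 γ
    have q2 := Real.rpow_pos_of_pos h2 γ
    rw [Real.mul_rpow h1.le h2.le]
    -- The larger of the two distances is at least `(b - a) / 2`; its negative power is bounded by a
    -- constant.
    rcases le_total (x - a) (b - x) with hc | hc
    · have := Real.rpow_le_rpow_of_nonpos (z := γ) (x := (b - a) / 2) (y := b - x)
        (by linarith) (by linarith) (by linarith)
      have q3 := Real.rpow_pos_of_pos (x := (b - a) / 2) (by linarith) γ
      nlinarith
    · have := Real.rpow_le_rpow_of_nonpos (z := γ) (x := (b - a) / 2) (y := x - a)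
        (by linarith) (by linarith) (by linarith)
      have q3 := Real.rpow_pos_of_pos (x := (b - a) / 2) (by linarith) γ
      nlinarith
  have hint := intervalIntegral.norm_integral_le_of_norm_le hle
    (Eventually.of_forall hb) (((n1.add n2).const_mul _).const_mul K)
  rw [intervalIntegral.integral_const_mul, intervalIntegral.integral_const_mul,
    intervalIntegral.integral_add n1 n2, i1, i2] at hint
  refine hint.trans ?_
  rw [mul_assoc K]
  refine mul_le_mul_of_nonneg_left ?_ hK0
  rw [mul_assoc]
  refine mul_le_mul_of_nonneg_left ?_ (by positivity)
  have e : h ^ (γ + 1) = ((b - a) / 4) ^ (γ + 1) * κ ^ (-γ - 1) := by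
    have : h = ((b - a) / 4) * κ⁻¹ := by rw [hh]; field_simp
    rw [this, Real.mul_rpow (by positivity) (by positivity), Real.inv_rpow hκ0.le,
      ← Real.rpow_neg hκ0.le]
    ring_nf
  have hp : 0 ≤ (b - a - h) ^ (γ + 1) := Real.rpow_nonneg (by linarith) _
  have e2 : ((b - a - h) ^ (γ + 1) - h ^ (γ + 1)) / (γ + 1) ≤ h ^ (γ + 1) / -(γ + 1) := by
    rw [div_neg, ← neg_div, div_le_div_right_of_neg hγ]
    linarith
  rw [e] at e2
  calc _ ≤ ((b - a) / 4) ^ (γ + 1) * κ ^ (-γ - 1) / -(γ + 1) +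
        ((b - a) / 4) ^ (γ + 1) * κ ^ (-γ - 1) / -(γ + 1) := by
        rw [e]; exact add_le_add e2 e2
    _ = _ := by ring

lemma integral_mul_cos {p q κ φ : ℝ} (hpq : p ≤ q) (hκ : κ ≠ 0) {u v : ℝ → ℝ}
    (hu : ∀ x ∈ Icc p q, HasDerivAt u (v x) x) (hv : ContinuousOn v (Icc p q)) :
    ∫ x in p..q, u x * Real.cos (κ * x + φ) =
      (u q * Real.sin (κ * q + φ) - u p * Real.sin (κ * p + φ) -
        ∫ x in p..q, v x * Real.cos (κ * x + (φ - Real.pi / 2))) / κ := by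
  have hs : ∀ x, HasDerivAt (fun x => Real.sin (κ * x + φ) / κ) (Real.cos (κ * x + φ)) x := by
    intro x
    have h0 : HasDerivAt (fun x => κ * x + φ) κ x := by
      simpa using ((hasDerivAt_id x).const_mul κ).add_const φ
    have := h0.sin.div_const κ
    rwa [mul_div_cancel_right₀ _ hκ] at this
  rw [intervalIntegral.integral_mul_deriv_eq_deriv_mul (u := u) (u' := v)
    (v := fun x => Real.sin (κ * x + φ) / κ) (by rwa [uIcc_of_le hpq]) (fun x _ => hs x)
    (ContinuousOn.intervalIntegrable (by rwa [uIcc_of_le hpq]))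
    (Continuous.intervalIntegrable (by fun_prop) _ _)]
  have : ∀ x, v x * (Real.sin (κ * x + φ) / κ) =
      v x * Real.cos (κ * x + (φ - Real.pi / 2)) / κ := by
    intro x
    rw [← add_sub_assoc, Real.cos_sub_pi_div_two]; ring
  simp_rw [this, intervalIntegral.integral_div]
  ring

/-- Each integration by parts lowers the order by one and gains `1 / κ`; the boundary terms, at
distance of order `1 / κ` from the ends, already have the claimed size. After `N` steps the order is
below `-1` and absolute values suffice. The phase `φ` is arbitrary because every step shifts it by
`π / 2`. -/
lemma abs_integral_middle_le {a b : ℝ} (hab : a < b) {N : ℕ} {γ : ℝ} {u : ℝ → ℝ}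
    (hu : ArcSymbol a b N γ u) (hN : γ + 1 < N) :
    ∃ K, ∀ κ φ : ℝ, 1 ≤ κ →
      |∫ x in (a + (b - a) / (4 * κ))..(b - (b - a) / (4 * κ)), u x * Real.cos (κ * x + φ)| ≤
        K * κ ^ (-γ - 1) := by
  induction N generalizing γ u with
  | zero =>
    obtain ⟨K, hK0, hK⟩ := hu.bound
    refine ⟨_, fun κ φ hκ => integral_weight_rpow_le hab (by simpa using hN) hκ hK0 fun x hx => ?_⟩
    rw [abs_mul]
    exact (mul_le_of_le_one_right (abs_nonneg _) (Real.abs_cos_le_one _)).trans (hK x hx)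
  | succ N ih =>
    obtain ⟨K, hK0, hK⟩ := hu.bound
    obtain ⟨-, v, hv, hs⟩ := hu
    push_cast at hN
    obtain ⟨K', hK'⟩ := ih hs (by linarith)
    have hL : 0 < b - a := sub_pos.2 hab
    -- The sum of the two powers bounds `(b - a - h) ^ γ` for either sign of `γ`, as `b - a - h`
    -- lies between the two bases.
    set B := ((b - a) / 4) ^ γ * ((3 * (b - a) / 4) ^ γ + (b - a) ^ γ) with hB
    refine ⟨K * B + K * B + K', fun κ φ hκ => ?_⟩
    have hκ0 : 0 < κ := by linarith
    set h := (b - a) / (4 * κ) with hh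
    have hh0 : 0 < h := by positivity
    have hh4 : h ≤ (b - a) / 4 := by
      rw [hh]; gcongr; linarith
    have hle : a + h ≤ b - h := by linarith
    have hsub : Icc (a + h) (b - h) ⊆ Ioo a b := fun x hx =>
      ⟨by linarith [hx.1], by linarith [hx.2]⟩
    have hw : (h * (b - a - h)) ^ γ ≤ B * κ ^ (-γ) := by
      have e : h = ((b - a) / 4) * κ⁻¹ := by rw [hh]; field_simp
      rw [Real.mul_rpow hh0.le (by linarith)]
      have e2 : h ^ γ = ((b - a) / 4) ^ γ * κ ^ (-γ) := by
        rw [e, Real.mul_rpow (by positivity) (by positivity), Real.inv_rpow hκ0.le,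
          ← Real.rpow_neg hκ0.le]
      have e3 : (b - a - h) ^ γ ≤ (3 * (b - a) / 4) ^ γ + (b - a) ^ γ := by
        have q1 : 0 < (3 * (b - a) / 4) ^ γ := by positivity
        have q2 : 0 < (b - a) ^ γ := by positivity
        rcases le_total 0 γ with hg | hg
        · have := Real.rpow_le_rpow (x := b - a - h) (y := b - a) (by linarith) (by linarith) hg
          linarith
        · have := Real.rpow_le_rpow_of_nonpos (x := 3 * (b - a) / 4) (y := b - a - h)
            (by linarith) (by linarith) hg
          linarith
      rw [e2, hB, mul_assoc, mul_assoc, mul_comm (κ ^ (-γ))]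
      gcongr
    have b1 : |u (b - h) * Real.sin (κ * (b - h) + φ)| ≤ K * B * κ ^ (-γ) := by
      rw [abs_mul]
      refine (mul_le_of_le_one_right (abs_nonneg _) (Real.abs_sin_le_one _)).trans
        ((hK _ (hsub ⟨hle, le_rfl⟩)).trans ?_)
      rw [mul_assoc]
      refine mul_le_mul_of_nonneg_left (le_of_eq_of_le ?_ hw) hK0
      ring_nf
    have b2 : |u (a + h) * Real.sin (κ * (a + h) + φ)| ≤ K * B * κ ^ (-γ) := by
      rw [abs_mul]
      refine (mul_le_of_le_one_right (abs_nonneg _) (Real.abs_sin_le_one _)).trans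
        ((hK _ (hsub ⟨le_rfl, hle⟩)).trans ?_)
      rw [mul_assoc]
      refine mul_le_mul_of_nonneg_left (le_of_eq_of_le ?_ hw) hK0
      ring_nf
    have b3 := hK' κ (φ - Real.pi / 2) hκ
    rw [show -(γ - 1) - 1 = -γ by ring] at b3
    rw [integral_mul_cos hle hκ0.ne' (fun x hx => hv x (hsub hx)) (hs.continuousOn.mono hsub),
      abs_div, abs_of_pos hκ0, div_le_iff₀ hκ0, mul_assoc, Real.rpow_sub_one hκ0.ne',
      div_mul_cancel₀ _ hκ0.ne']
    calc _ ≤ |u (b - h) * Real.sin (κ * (b - h) + φ)| + |u (a + h) * Real.sin (κ * (a + h) + φ)|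
          + _ := (abs_sub _ _).trans (add_le_add_left (abs_sub _ _) _)
      _ ≤ K * B * κ ^ (-γ) + K * B * κ ^ (-γ) + K' * κ ^ (-γ) := by gcongr
      _ = _ := by ring

/-- Decay of the oscillatory integrals of a symbol. -/
theorem abs_integral_mul_cos_le {a b : ℝ} (hab : a < b) {N : ℕ} {γ : ℝ} {u : ℝ → ℝ}
    (hu : ArcSymbol a b N γ u) (hN : γ + 1 < N) (hγ : 0 ≤ γ) (hc : Continuous u) :
    ∃ K, ∀ κ φ : ℝ, 1 ≤ κ →
      |∫ x in a..b, u x * Real.cos (κ * x + φ)| ≤ K * κ ^ (-γ - 1) := by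
  obtain ⟨K, hK0, hK⟩ := hu.bound
  obtain ⟨K', hK'⟩ := abs_integral_middle_le hab hu hN
  have hL : 0 < b - a := sub_pos.2 hab
  -- On the two end pieces of length `h` the integrand is at most `K (h (b - a)) ^ γ`, so no
  -- cancellation is needed there.
  set B := K * (((b - a) / 4) * (b - a)) ^ γ * ((b - a) / 4) with hB
  refine ⟨B + K' + B, fun κ φ hκ => ?_⟩
  have hκ0 : 0 < κ := by linarith
  set h := (b - a) / (4 * κ) with hh
  have hh0 : 0 < h := by positivity
  have hh4 : h ≤ (b - a) / 4 := by
    rw [hh]; gcongr; linarith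
  have hint : ∀ p q, IntervalIntegrable (fun x => u x * Real.cos (κ * x + φ))
      MeasureTheory.volume p q := fun p q => Continuous.intervalIntegrable (by fun_prop) _ _
  have ends : ∀ x ∈ Ioo a b, (x - a) * (b - x) ≤ h * (b - a) →
      ‖u x * Real.cos (κ * x + φ)‖ ≤ K * (h * (b - a)) ^ γ := by
    intro x hx hle
    rw [norm_mul]
    refine (mul_le_of_le_one_right (norm_nonneg _) (Real.abs_cos_le_one _)).trans
      ((hK x hx).trans ?_)
    gcongr
    exact (weight_pos hx).le
  have hend : K * (h * (b - a)) ^ γ * h = B * κ ^ (-γ - 1) := by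
    have e : h = ((b - a) / 4) * κ⁻¹ := by rw [hh]; field_simp
    have e2 : h * (b - a) = ((b - a) / 4) * (b - a) * κ⁻¹ := by rw [e]; ring
    rw [e2, Real.mul_rpow (by positivity) (by positivity), Real.inv_rpow hκ0.le,
      ← Real.rpow_neg hκ0.le, Real.rpow_sub_one hκ0.ne', e, hB]
    ring
  have e1 : |∫ x in a..(a + h), u x * Real.cos (κ * x + φ)| ≤ B * κ ^ (-γ - 1) := by
    rw [← hend, ← Real.norm_eq_abs]
    refine (intervalIntegral.norm_integral_le_of_norm_le_const
      (C := K * (h * (b - a)) ^ γ) fun x hx => ?_).trans_eq ?_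
    · rw [uIoc_of_le (by linarith)] at hx
      exact ends x ⟨hx.1, by linarith [hx.2]⟩ (mul_le_mul (by linarith [hx.2]) (by linarith [hx.1])
        (by linarith [hx.2]) hh0.le)
    · rw [add_sub_cancel_left, abs_of_pos hh0]
  have e2 : |∫ x in (b - h)..b, u x * Real.cos (κ * x + φ)| ≤ B * κ ^ (-γ - 1) := by
    rw [← hend, ← Real.norm_eq_abs]
    refine (intervalIntegral.norm_integral_le_of_norm_le_const_ae
      (C := K * (h * (b - a)) ^ γ) ?_).trans_eq ?_
    · filter_upwards [MeasureTheory.Measure.ae_ne MeasureTheory.volume b] with x hxb hx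
      rw [uIoc_of_le (by linarith)] at hx
      have hlt := lt_of_le_of_ne hx.2 hxb
      refine ends x ⟨by linarith [hx.1], hlt⟩ ?_
      rw [mul_comm]
      exact mul_le_mul (by linarith [hx.1]) (by linarith) (by linarith [hx.1]) hh0.le
    · rw [sub_sub_cancel, abs_of_pos hh0]
  have e3 := hK' κ φ hκ
  rw [← intervalIntegral.integral_add_adjacent_intervals (hint a (b - h)) (hint _ _),
    ← intervalIntegral.integral_add_adjacent_intervals (hint a (a + h)) (hint _ _)]
  calc _ ≤ _ := (abs_add_le _ _).trans (add_le_add_left (abs_add_le _ _) _)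
    _ ≤ B * κ ^ (-γ - 1) + K' * κ ^ (-γ - 1) + B * κ ^ (-γ - 1) := by gcongr
    _ = _ := by ring

end ArcSymbol

/-! ### Chebyshev series as Fourier cosine series -/

section ChebyshevSeries

open MeasureTheory

lemma chebCoeff_eq_integral_cos (f : ℝ → ℝ) (k : ℕ) :
    chebCoeff f k = 2 / Real.pi * ∫ θ in (0 : ℝ)..Real.pi, f (Real.cos θ) * Real.cos (k * θ) := by
  have h := Chebyshev.integral_measureT_eq_integral_cos
    (f := fun x => f x * (Chebyshev.T ℝ (k : ℤ)).eval x)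
  rw [Chebyshev.integral_measureT] at h
  simp only [Chebyshev.T_real_cos, Int.cast_natCast] at h
  rw [chebCoeff, ← h]
  simp only [Real.sqrt_inv, div_eq_mul_inv]

lemma continuous_comp_cos {f : ℝ → ℝ} (hf : ContinuousOn f (Icc (-1) 1)) :
    Continuous fun θ => f (Real.cos θ) :=
  hf.comp_continuous Real.continuous_cos fun θ => ⟨Real.neg_one_le_cos θ, Real.cos_le_one θ⟩

lemma integral_neg_pi_pi_of_even {h : ℝ → ℝ} (hc : Continuous h) (he : ∀ θ, h (-θ) = h θ) :
    ∫ θ in (-Real.pi)..Real.pi, h θ = 2 * ∫ θ in (0 : ℝ)..Real.pi, h θ := by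
  rw [← intervalIntegral.integral_add_adjacent_intervals (b := 0) (hc.intervalIntegrable _ _)
    (hc.intervalIntegrable _ _)]
  have := intervalIntegral.integral_comp_neg (a := 0) (b := Real.pi) h
  simp only [he, neg_zero] at this
  rw [← this, two_mul]

lemma integral_neg_pi_pi_of_odd {h : ℝ → ℝ} (he : ∀ θ, h (-θ) = -h θ) :
    ∫ θ in (-Real.pi)..Real.pi, h θ = 0 := by
  have := intervalIntegral.integral_comp_neg (a := -Real.pi) (b := Real.pi) h
  simp only [he, neg_neg, intervalIntegral.integral_neg] at this
  linarith

lemma integral_period_eq {h : ℝ → ℝ} (hp : Function.Periodic h (2 * Real.pi)) (a : ℝ) :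
    ∫ θ in a..(a + 2 * Real.pi), h θ = ∫ θ in (-Real.pi)..Real.pi, h θ := by
  rw [hp.intervalIntegral_add_eq a (-Real.pi)]
  congr 1; ring

lemma periodic_comp_cos_mul_cos (f : ℝ → ℝ) (k : ℕ) :
    Function.Periodic (fun θ => f (Real.cos θ) * Real.cos (k * θ)) (2 * Real.pi) := by
  intro θ
  simp only [Real.cos_add_two_pi, mul_add]
  rw [Real.cos_add_nat_mul_two_pi]

lemma periodic_comp_cos_mul_sin (f : ℝ → ℝ) (k : ℕ) :
    Function.Periodic (fun θ => f (Real.cos θ) * Real.sin (k * θ)) (2 * Real.pi) := by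
  intro θ
  simp only [Real.cos_add_two_pi, mul_add]
  rw [Real.sin_add_nat_mul_two_pi]

lemma integral_period_comp_cos_mul_cos {f : ℝ → ℝ} (hf : ContinuousOn f (Icc (-1) 1)) (k : ℕ)
    (a : ℝ) :
    ∫ θ in a..(a + 2 * Real.pi), f (Real.cos θ) * Real.cos (k * θ) =
      Real.pi * chebCoeff f k := by
  have := continuous_comp_cos hf
  rw [integral_period_eq (periodic_comp_cos_mul_cos f k),
    integral_neg_pi_pi_of_even (h := fun θ => f (Real.cos θ) * Real.cos (k * θ))
      (this.mul (by fun_prop)) (by intro θ; simp), chebCoeff_eq_integral_cos]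
  field_simp

lemma integral_period_comp_cos_mul_sin (f : ℝ → ℝ) (k : ℕ) (a : ℝ) :
    ∫ θ in a..(a + 2 * Real.pi), f (Real.cos θ) * Real.sin (k * θ) = 0 := by
  rw [integral_period_eq (periodic_comp_cos_mul_sin f k), integral_neg_pi_pi_of_odd]
  intro θ; simp

lemma eval_chebProj (f : ℝ → ℝ) (n : ℕ) (x : ℝ) :
    (chebProj f n).eval x = ∑ k ∈ Finset.range (n + 1),
      (if k = 0 then 1 / 2 else 1) * chebCoeff f k * (Chebyshev.T ℝ (k : ℤ)).eval x := by
  simp [chebProj, eval_finsetSum]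

lemma eval_derivative_chebProj (f : ℝ → ℝ) (n : ℕ) (x : ℝ) :
    (derivative (chebProj f n)).eval x = ∑ k ∈ Finset.range (n + 1),
      chebCoeff f k * (derivative (Chebyshev.T ℝ (k : ℤ))).eval x := by
  simp only [chebProj, derivative_sum, derivative_C_mul, eval_finsetSum, eval_mul, eval_C]
  refine Finset.sum_congr rfl fun k _ => ?_
  rcases eq_or_ne k 0 with rfl | hk
  · simp
  · simp [hk]

/-- The function `θ ↦ f (cos θ)` on the circle. -/
noncomputable def circleFun (f : ℝ → ℝ) (hf : ContinuousOn f (Icc (-1) 1)) :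
    C(AddCircle (2 * Real.pi), ℂ) where
  toFun := Function.Periodic.lift (f := fun θ : ℝ => ((f (Real.cos θ) : ℝ) : ℂ))
    (fun θ => by simp only [Real.cos_add_two_pi])
  continuous_toFun := by
    refine continuous_coinduced_dom.2 ?_
    exact Complex.continuous_ofReal.comp (continuous_comp_cos hf)

lemma circleFun_coe {f : ℝ → ℝ} (hf : ContinuousOn f (Icc (-1) 1)) (θ : ℝ) :
    circleFun f hf (θ : AddCircle (2 * Real.pi)) = f (Real.cos θ) := rfl

lemma fourier_two_pi (n : ℤ) (θ : ℝ) :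
    fourier n (θ : AddCircle (2 * Real.pi)) =
      (Real.cos (n * θ) : ℂ) + (Real.sin (n * θ) : ℂ) * Complex.I := by
  rw [fourier_coe_apply, Complex.ofReal_cos, Complex.ofReal_sin, ← Complex.exp_mul_I]
  congr 1
  push_cast
  field_simp

/-- Since `f (cos θ)` is even, the sine part integrates to zero. -/
lemma fourierCoeff_circleFun [Fact (0 < 2 * Real.pi)] {f : ℝ → ℝ}
    (hf : ContinuousOn f (Icc (-1) 1)) (n : ℤ) :
    fourierCoeff (circleFun f hf) n = ((chebCoeff f n.natAbs / 2 : ℝ) : ℂ) := by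
  rw [fourierCoeff_eq_intervalIntegral _ n (-Real.pi)]
  have hc := continuous_comp_cos hf
  have e : ∀ θ : ℝ, fourier (-n) (θ : AddCircle (2 * Real.pi)) • circleFun f hf θ =
      ((f (Real.cos θ) * Real.cos (n.natAbs * θ) : ℝ) : ℂ) +
        ((f (Real.cos θ) * Real.sin (((-n : ℤ) : ℝ) * θ) : ℝ) : ℂ) * Complex.I := by
    intro θ
    rw [fourier_two_pi, circleFun_coe]
    have : Real.cos (((-n : ℤ) : ℝ) * θ) = Real.cos (n.natAbs * θ) := by
      rcases Int.natAbs_eq n with h | h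
      · rw [h]; simp
      · rw [h]; simp
    rw [this]
    push_cast
    simp only [smul_eq_mul]
    ring
  simp_rw [e]
  rw [intervalIntegral.integral_add, intervalIntegral.integral_mul_const,
    intervalIntegral.integral_ofReal, intervalIntegral.integral_ofReal]
  · have h1 := integral_period_comp_cos_mul_cos hf n.natAbs (-Real.pi)
    rw [h1]
    have h2 : ∫ θ in (-Real.pi)..(-Real.pi + 2 * Real.pi),
        f (Real.cos θ) * Real.sin (((-n : ℤ) : ℝ) * θ) = 0 := by
      rw [show -Real.pi + 2 * Real.pi = Real.pi by ring]
      refine integral_neg_pi_pi_of_odd fun θ => ?_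
      simp
    rw [h2]
    push_cast
    have := Real.pi_ne_zero
    simp only [Complex.real_smul]
    push_cast
    field_simp
    simp
  · exact (Complex.continuous_ofReal.comp (hc.mul (by fun_prop))).intervalIntegrable _ _
  · exact ((Complex.continuous_ofReal.comp (hc.mul (by fun_prop))).mul
      continuous_const).intervalIntegrable _ _

/-- The Chebyshev series of a continuous function converges to it if the coefficients are
summable. -/
theorem tendsto_eval_chebProj {f : ℝ → ℝ} (hf : ContinuousOn f (Icc (-1) 1))
    (hs : Summable (chebCoeff f)) {x : ℝ} (hx : x ∈ Icc (-1 : ℝ) 1) :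
    Tendsto (fun n => (chebProj f n).eval x) atTop (nhds (f x)) := by
  have : Fact (0 < 2 * Real.pi) := ⟨Real.two_pi_pos⟩
  obtain ⟨θ, rfl⟩ : ∃ θ, Real.cos θ = x := ⟨Real.arccos x, Real.cos_arccos hx.1 hx.2⟩
  have hsum : Summable (fourierCoeff (circleFun f hf)) := by
    have h1 : Summable fun n : ℕ => ((chebCoeff f n / 2 : ℝ) : ℂ) :=
      Complex.ofRealCLM.summable (hs.div_const 2)
    refine Summable.of_nat_of_neg ?_ ?_
    · simpa only [fourierCoeff_circleFun hf, Int.natAbs_natCast] using h1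
    · simpa only [fourierCoeff_circleFun hf, Int.natAbs_neg, Int.natAbs_natCast] using h1
  have h := (has_pointwise_sum_fourier_series_of_summable hsum
    (θ : AddCircle (2 * Real.pi))).nat_add_neg.tendsto_sum_nat
  have h' := (Complex.continuous_re.tendsto _).comp (h.comp (tendsto_add_atTop_nat 1))
  have h0 : (fourierCoeff (circleFun f hf) 0 •
      fourier 0 (θ : AddCircle (2 * Real.pi)) : ℂ) = ((chebCoeff f 0 / 2 : ℝ) : ℂ) := by
    rw [fourierCoeff_circleFun hf, fourier_zero]; simp
  rw [h0, circleFun_coe] at h'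
  -- Pairing `n` with `-n` counts the index `0` twice; one copy is removed, which leaves the halved
  -- constant term of the projection.
  have h2 := h'.sub_const (chebCoeff f 0 / 2)
  simp only [Complex.add_re, Complex.ofReal_re, add_sub_cancel_right] at h2
  refine h2.congr fun n => ?_
  simp only [Function.comp_apply, eval_chebProj, Finset.sum_range_succ',
    fourierCoeff_circleFun hf, Chebyshev.T_real_cos]
  rw [Complex.add_re, Complex.re_sum, add_sub_assoc]
  congr 1
  · refine Finset.sum_congr rfl fun k _ => ?_
    rw [if_neg k.succ_ne_zero]
    generalize k + 1 = j
    simp only [fourier_two_pi, Int.natAbs_neg, Int.natAbs_natCast, Int.cast_neg, neg_mul,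
      Real.cos_neg, Real.sin_neg, smul_eq_mul, Int.cast_natCast, Complex.add_re,
      Complex.re_ofReal_mul, Complex.ofReal_re, Complex.I_re, Complex.neg_re, Complex.ofReal_neg]
    ring
  · simp
    ring

end ChebyshevSeries

/-! ### Tails of power-like series -/

section TailEstimates

/-- A telescoping substitute for comparing a sum with the integral of `x ^ (-s)`; it follows from
`exp y ≥ 1 + y` and `log y ≤ y - 1`. -/
lemma sub_one_mul_rpow_le {s : ℝ} (hs : 1 < s) {n : ℕ} (hn : 1 ≤ n) :
    (s - 1) * ((n + 1 : ℕ) : ℝ) ^ (-s) ≤ (n : ℝ) ^ (1 - s) - ((n + 1 : ℕ) : ℝ) ^ (1 - s) := by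
  have hn0 : (0 : ℝ) < n := by exact_mod_cast hn
  have hm0 : (0 : ℝ) < ((n + 1 : ℕ) : ℝ) := by positivity
  set m : ℝ := ((n + 1 : ℕ) : ℝ) with hm
  have hnm : (n : ℝ) = m - 1 := by rw [hm]; push_cast; ring
  have hx : 0 < (n : ℝ) / m := by positivity
  have h1 : (n : ℝ) ^ (1 - s) = m ^ (1 - s) * ((n : ℝ) / m) ^ (1 - s) := by
    rw [← Real.mul_rpow hm0.le hx.le, mul_div_cancel₀ _ hm0.ne']
  have h2 : 1 + (s - 1) * (1 / m) ≤ ((n : ℝ) / m) ^ (1 - s) := by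
    rw [Real.rpow_def_of_pos hx]
    have h3 := Real.add_one_le_exp (Real.log ((n : ℝ) / m) * (1 - s))
    have h4 := Real.log_le_sub_one_of_pos hx
    have h5 : (n : ℝ) / m - 1 = -(1 / m) := by rw [hnm]; field_simp; ring
    rw [h5] at h4
    nlinarith
  have h6 : m ^ (-s) = m ^ (1 - s) * (1 / m) := by
    rw [show -s = 1 - s - 1 by ring, Real.rpow_sub_one hm0.ne']; ring
  have h7 : 0 < m ^ (1 - s) := Real.rpow_pos_of_pos hm0 _
  rw [h1, h6]
  nlinarith

lemma abs_le_of_abs_sub_succ_le {s C : ℝ} (hs : 1 < s) (hC : 0 ≤ C) {E : ℕ → ℝ}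
    (hE : Tendsto E atTop (nhds 0))
    (h : ∀ n : ℕ, 1 ≤ n → |E n - E (n + 1)| ≤ C * ((n + 1 : ℕ) : ℝ) ^ (-s)) (n : ℕ)
    (hn : 1 ≤ n) : |E n| ≤ C / (s - 1) * (n : ℝ) ^ (1 - s) := by
  have hs1 : 0 < s - 1 := sub_pos.2 hs
  have key : ∀ j : ℕ, |E n| ≤ |E (n + j)| +
      C / (s - 1) * ((n : ℝ) ^ (1 - s) - ((n + j : ℕ) : ℝ) ^ (1 - s)) := by
    intro j
    induction j with
    | zero => simp
    | succ j ih =>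
      have h1 := h (n + j) (by omega)
      have h2 := mul_le_mul_of_nonneg_left (sub_one_mul_rpow_le hs (n := n + j) (by omega))
        (div_nonneg hC hs1.le)
      have h3 : |E (n + j)| ≤ |E (n + j + 1)| + |E (n + j) - E (n + j + 1)| := by
        have := abs_add_le (E (n + j + 1)) (E (n + j) - E (n + j + 1))
        simpa using this
      have h4 : C / (s - 1) * ((s - 1) * ((n + j + 1 : ℕ) : ℝ) ^ (-s)) =
          C * ((n + j + 1 : ℕ) : ℝ) ^ (-s) := by field_simp
      rw [h4] at h2
      rw [← add_assoc]
      linarith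
  have h5 : ∀ j : ℕ, |E n| ≤ |E (n + j)| + C / (s - 1) * (n : ℝ) ^ (1 - s) := by
    intro j
    refine (key j).trans ?_
    gcongr
    exact sub_le_self _ (Real.rpow_nonneg (Nat.cast_nonneg _) _)
  have h6 : Tendsto (fun j => |E (n + j)| + C / (s - 1) * (n : ℝ) ^ (1 - s)) atTop
      (nhds (0 + C / (s - 1) * (n : ℝ) ^ (1 - s))) := by
    refine Tendsto.add_const _ ?_
    have := (hE.comp (tendsto_add_atTop_nat n)).abs
    rw [abs_zero] at this
    exact this.congr fun j => by simp [add_comm]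
  rw [zero_add] at h6
  exact ge_of_tendsto' h6 h5

lemma summable_mul_rpow_of_le {s C : ℝ} (hs : 1 < s) {a : ℕ → ℝ}
    (ha : ∀ k : ℕ, 1 ≤ k → |a k| ≤ C * (k : ℝ) ^ (-s)) : Summable a := by
  rw [← summable_nat_add_iff 1]
  refine Summable.of_norm_bounded (g := fun k : ℕ => C * ((k + 1 : ℕ) : ℝ) ^ (-s)) ?_
    fun k => ha (k + 1) (by omega)
  exact ((summable_nat_add_iff (f := fun k : ℕ => (k : ℝ) ^ (-s)) 1).2
    (Real.summable_nat_rpow.2 (by linarith))).mul_left C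

lemma nonneg_of_abs_le_rpow {s C : ℝ} {a : ℕ → ℝ}
    (ha : ∀ k : ℕ, 1 ≤ k → |a k| ≤ C * (k : ℝ) ^ (-s)) : 0 ≤ C := by
  have := (abs_nonneg _).trans (ha 1 le_rfl)
  simpa using this

end TailEstimates

/-! ### Termwise differentiation and direct error bounds -/

section ChebyshevDerivative

lemma abs_eval_derivative_T_le_sq (k : ℕ) {x : ℝ} (hx : |x| ≤ 1) :
    |(derivative (Chebyshev.T ℝ (k : ℤ))).eval x| ≤ (k : ℝ) ^ (2 : ℝ) := by
  have := Chebyshev.abs_iterate_derivative_T_real_le k 1 hx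
  simp only [Function.iterate_one, Chebyshev.derivative_T_eval_one] at this
  simpa using this

/-- This is `T_k' = k U_{k-1}`. It yields both the linear bound on `T_k'` inside the interval and
the sine series of the error at `ξ`. -/
lemma eval_derivative_T_cos_mul_sin (k : ℕ) (θ : ℝ) :
    (derivative (Chebyshev.T ℝ (k : ℤ))).eval (Real.cos θ) * Real.sin θ =
      k * Real.sin (k * θ) := by
  rw [Chebyshev.T_derivative_eq_U, eval_mul, mul_assoc, Chebyshev.U_real_cos]
  simp

lemma abs_eval_derivative_T_le_mul (k : ℕ) {r : ℝ} (hr : r < 1) {x : ℝ} (hx : x ∈ Ioo (-r) r) :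
    |(derivative (Chebyshev.T ℝ (k : ℤ))).eval x| ≤ 1 / √(1 - r ^ 2) * (k : ℝ) ^ (1 : ℝ) := by
  have hr0 : 0 < r := by linarith [hx.1, hx.2]
  have hr1 : 0 < 1 - r ^ 2 := by nlinarith
  have hxr : x ^ 2 ≤ r ^ 2 := sq_le_sq' hx.1.le hx.2.le
  have hs : √(1 - r ^ 2) ≤ √(1 - x ^ 2) := Real.sqrt_le_sqrt (by linarith)
  have hs0 : 0 < √(1 - r ^ 2) := Real.sqrt_pos.2 hr1
  have h := eval_derivative_T_cos_mul_sin k (Real.arccos x)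
  rw [Real.cos_arccos (by linarith [hx.1]) (by linarith [hx.2]), Real.sin_arccos] at h
  have h1 : |(derivative (Chebyshev.T ℝ (k : ℤ))).eval x| * √(1 - x ^ 2) ≤ k := by
    rw [← abs_of_nonneg (Real.sqrt_nonneg (1 - x ^ 2)), ← abs_mul, h, abs_mul, Nat.abs_cast]
    exact mul_le_of_le_one_right (Nat.cast_nonneg k) (Real.abs_sin_le_one _)
  rw [Real.rpow_one, one_div_mul_eq_div, le_div_iff₀ hs0]
  exact (mul_le_mul_of_nonneg_left hs (abs_nonneg _)).trans h1

variable {f : ℝ → ℝ}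

lemma chebProj_succ (f : ℝ → ℝ) (n : ℕ) (x : ℝ) :
    (chebProj f (n + 1)).eval x = (chebProj f n).eval x +
      chebCoeff f (n + 1) * (Chebyshev.T ℝ ((n + 1 : ℕ) : ℤ)).eval x := by
  rw [eval_chebProj, Finset.sum_range_succ, ← eval_chebProj]
  simp

lemma derivative_chebProj_succ (f : ℝ → ℝ) (n : ℕ) (x : ℝ) :
    (derivative (chebProj f (n + 1))).eval x = (derivative (chebProj f n)).eval x +
      chebCoeff f (n + 1) * (derivative (Chebyshev.T ℝ ((n + 1 : ℕ) : ℤ))).eval x := by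
  rw [eval_derivative_chebProj, Finset.sum_range_succ, ← eval_derivative_chebProj]

lemma hasDerivAt_of_mem_Ioo (hf : ContDiffOn ℝ 1 f (Icc (-1) 1)) {x : ℝ}
    (hx : x ∈ Ioo (-1 : ℝ) 1) : HasDerivAt f (derivWithin f (Icc (-1) 1) x) x :=
  ((hf.differentiableOn (by simp) x (Ioo_subset_Icc_self hx)).hasDerivWithinAt).hasDerivAt
    (Icc_mem_nhds hx.1 hx.2)

/-- Termwise differentiation of the Chebyshev series. -/
lemma tendsto_chebDiffError (hf : ContDiffOn ℝ 1 f (Icc (-1) 1)) {A s p M r : ℝ} (hr : r ≤ 1)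
    (hp : 0 ≤ p) (hs : 1 < s - p) (ha : ∀ k : ℕ, 1 ≤ k → |chebCoeff f k| ≤ A * (k : ℝ) ^ (-s))
    (hT : ∀ k : ℕ, ∀ y ∈ Ioo (-r) r,
      |(derivative (Chebyshev.T ℝ (k : ℤ))).eval y| ≤ M * (k : ℝ) ^ p)
    {x : ℝ} (hx : x ∈ Ioo (-r) r) : Tendsto (fun n => chebDiffError f n x) atTop (nhds 0) := by
  have hsub : Ioo (-r) r ⊆ Icc (-1) 1 := fun y hy => ⟨by linarith [hy.1], by linarith [hy.2]⟩
  have hA := nonneg_of_abs_le_rpow ha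
  have hsum : Summable (chebCoeff f) := summable_mul_rpow_of_le (by linarith) ha
  set c : ℕ → ℝ := fun k => (if k = 0 then 1 / 2 else 1) * chebCoeff f k with hc
  have hcs : Summable c := by
    rw [← summable_nat_add_iff 1]
    simpa [hc] using (summable_nat_add_iff 1).2 hsum
  have hS : ∀ y ∈ Icc (-1 : ℝ) 1,
      HasSum (fun k : ℕ => c k * (Chebyshev.T ℝ (k : ℤ)).eval y) (f y) := by
    intro y hy
    have hsy : Summable fun k : ℕ => c k * (Chebyshev.T ℝ (k : ℤ)).eval y := by
      refine Summable.of_norm_bounded hcs.norm fun k => ?_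
      rw [norm_mul]
      exact mul_le_of_le_one_right (norm_nonneg _)
        (Chebyshev.abs_eval_T_real_le_one k (abs_le.2 hy))
    have h1 := hsy.hasSum.tendsto_sum_nat.comp (tendsto_add_atTop_nat 1)
    have h2 := tendsto_eval_chebProj hf.continuousOn hsum hy
    have h3 := tendsto_nhds_unique h1 (h2.congr fun n => eval_chebProj f n y)
    rw [← h3]
    exact hsy.hasSum
  have hu : Summable fun k : ℕ => |c k| * (M * (k : ℝ) ^ p) := by
    refine summable_mul_rpow_of_le (s := s - p) (C := A * |M|) hs fun k hk => ?_
    have hk0 : (0 : ℝ) < k := by exact_mod_cast hk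
    have hk1 : k ≠ 0 := by omega
    have e : (k : ℝ) ^ (-(s - p)) = (k : ℝ) ^ (-s) * (k : ℝ) ^ p := by
      rw [← Real.rpow_add hk0]; ring_nf
    rw [e, abs_mul, abs_abs, abs_mul M, abs_of_nonneg (Real.rpow_nonneg hk0.le p)]
    calc |c k| * (|M| * (k : ℝ) ^ p) ≤ A * (k : ℝ) ^ (-s) * (|M| * (k : ℝ) ^ p) := by
          gcongr
          simpa [hc, hk1] using ha k hk
      _ = _ := by ring
  have hder := hasDerivAt_tsum_of_isPreconnected hu isOpen_Ioo isPreconnected_Ioo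
    (g := fun (k : ℕ) y => c k * (Chebyshev.T ℝ (k : ℤ)).eval y)
    (g' := fun (k : ℕ) y => c k * (derivative (Chebyshev.T ℝ (k : ℤ))).eval y)
    (t := Ioo (-r) r) (y₀ := x) (y := x)
    (fun k y _ => ((Chebyshev.T ℝ (k : ℤ)).hasDerivAt y).const_mul (c k))
    (fun k y hy => by
      rw [norm_mul, Real.norm_eq_abs, Real.norm_eq_abs]
      exact mul_le_mul_of_nonneg_left (hT k y hy) (abs_nonneg _))
    hx (hS x (hsub hx)).summable hx
  have hder' : HasDerivAt f
      (∑' k : ℕ, c k * (derivative (Chebyshev.T ℝ (k : ℤ))).eval x) x := by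
    refine hder.congr_of_eventuallyEq ?_
    filter_upwards [Ioo_mem_nhds hx.1 hx.2] with y hy
    exact (hS y (hsub hy)).tsum_eq.symm
  have hfd := hasDerivAt_of_mem_Ioo hf (x := x) ⟨by linarith [hx.1], by linarith [hx.2]⟩
  have hsd : Summable fun k : ℕ => c k * (derivative (Chebyshev.T ℝ (k : ℤ))).eval x := by
    refine Summable.of_norm_bounded hu fun k => ?_
    rw [norm_mul, Real.norm_eq_abs, Real.norm_eq_abs]
    exact mul_le_mul_of_nonneg_left (hT k x hx) (abs_nonneg _)
  have h1 := hsd.hasSum.tendsto_sum_nat.comp (tendsto_add_atTop_nat 1)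
  rw [hder'.unique hfd] at h1
  have h2 : Tendsto (fun n => derivWithin f (Icc (-1) 1) x - (derivative (chebProj f n)).eval x)
      atTop (nhds (derivWithin f (Icc (-1) 1) x - derivWithin f (Icc (-1) 1) x)) := by
    refine Tendsto.sub tendsto_const_nhds (h1.congr fun n => ?_)
    rw [eval_derivative_chebProj]
    refine Finset.sum_congr rfl fun k _ => ?_
    rcases eq_or_ne k 0 with rfl | hk
    · simp
    · simp [hc, hk]
  rw [sub_self] at h2
  exact h2

lemma chebDiffError_sub_succ (f : ℝ → ℝ) (n : ℕ) (x : ℝ) :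
    chebDiffError f n x - chebDiffError f (n + 1) x =
      chebCoeff f (n + 1) * (derivative (Chebyshev.T ℝ ((n + 1 : ℕ) : ℤ))).eval x := by
  rw [chebDiffError, chebDiffError, derivative_chebProj_succ]; ring

lemma abs_chebDiffError_le (hf : ContDiffOn ℝ 1 f (Icc (-1) 1)) {A s p M r : ℝ} (hr : r ≤ 1)
    (hp : 0 ≤ p) (hs : 1 < s - p) (ha : ∀ k : ℕ, 1 ≤ k → |chebCoeff f k| ≤ A * (k : ℝ) ^ (-s))
    (hT : ∀ k : ℕ, ∀ y ∈ Ioo (-r) r,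
      |(derivative (Chebyshev.T ℝ (k : ℤ))).eval y| ≤ M * (k : ℝ) ^ p)
    {x : ℝ} (hx : x ∈ Ioo (-r) r) {n : ℕ} (hn : 1 ≤ n) :
    |chebDiffError f n x| ≤ A * |M| / (s - p - 1) * (n : ℝ) ^ (1 + p - s) := by
  have hA := nonneg_of_abs_le_rpow ha
  have := abs_le_of_abs_sub_succ_le (C := A * |M|) hs (by positivity)
    (tendsto_chebDiffError hf hr hp hs ha hT hx) (fun n _ => ?_) n hn
  · convert this using 3; ring
  have hk0 : (0 : ℝ) < ((n + 1 : ℕ) : ℝ) := by positivity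
  have e : ((n + 1 : ℕ) : ℝ) ^ (-(s - p)) =
      ((n + 1 : ℕ) : ℝ) ^ (-s) * ((n + 1 : ℕ) : ℝ) ^ p := by
    rw [← Real.rpow_add hk0]; ring_nf
  rw [chebDiffError_sub_succ, abs_mul, e]
  calc _ ≤ A * ((n + 1 : ℕ) : ℝ) ^ (-s) * (|M| * ((n + 1 : ℕ) : ℝ) ^ p) := by
        refine mul_le_mul (ha _ (by omega)) ((hT _ x hx).trans ?_) (abs_nonneg _) (by positivity)
        gcongr
        exact le_abs_self M
    _ = _ := by ring

lemma abs_sub_chebProj_le (hf : ContinuousOn f (Icc (-1) 1)) {A s : ℝ} (hs : 1 < s)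
    (ha : ∀ k : ℕ, 1 ≤ k → |chebCoeff f k| ≤ A * (k : ℝ) ^ (-s))
    {x : ℝ} (hx : x ∈ Icc (-1 : ℝ) 1) {n : ℕ} (hn : 1 ≤ n) :
    |f x - (chebProj f n).eval x| ≤ A / (s - 1) * (n : ℝ) ^ (1 - s) := by
  have hA := nonneg_of_abs_le_rpow ha
  refine abs_le_of_abs_sub_succ_le (E := fun n => f x - (chebProj f n).eval x) hs hA ?_
    (fun n _ => ?_) n hn
  · have := (tendsto_eval_chebProj hf (summable_mul_rpow_of_le hs ha) hx).const_sub (f x)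
    rwa [sub_self] at this
  · rw [chebProj_succ, sub_sub_sub_cancel_left, add_sub_cancel_left, abs_mul]
    exact (mul_le_of_le_one_right (abs_nonneg _)
      (Chebyshev.abs_eval_T_real_le_one _ (abs_le.2 hx))).trans (ha _ (by omega))

lemma continuousOn_chebDiffError (hf : ContDiffOn ℝ 1 f (Icc (-1) 1)) (n : ℕ) :
    ContinuousOn (chebDiffError f n) (Icc (-1) 1) :=
  (hf.continuousOn_derivWithin (uniqueDiffOn_Icc (by norm_num)) le_rfl).sub
    (derivative (chebProj f n)).continuousOn

/-- Termwise differentiation is carried out on open intervals only; bounds at `±1` come from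
continuity of the one-sided derivative. -/
lemma le_on_Icc_of_le_on_Ioo {g : ℝ → ℝ} (hg : ContinuousOn g (Icc (-1) 1)) {B : ℝ}
    (h : ∀ x ∈ Ioo (-1 : ℝ) 1, g x ≤ B) : ∀ x ∈ Icc (-1 : ℝ) 1, g x ≤ B := by
  intro x hx
  refine ContinuousWithinAt.closure_le (s := Ioo (-1 : ℝ) 1) (f := g) (g := fun _ => B) ?_
    ((hg x hx).mono Ioo_subset_Icc_self) continuousWithinAt_const h
  rwa [closure_Ioo (by norm_num)]

/-- Uniform estimate on `[-1, 1]`. -/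
lemma abs_chebDiffError_le_of_mem_Icc (hf : ContDiffOn ℝ 1 f (Icc (-1) 1)) {A s : ℝ}
    (hs : 3 < s) (ha : ∀ k : ℕ, 1 ≤ k → |chebCoeff f k| ≤ A * (k : ℝ) ^ (-s))
    {x : ℝ} (hx : x ∈ Icc (-1 : ℝ) 1) {n : ℕ} (hn : 1 ≤ n) :
    |chebDiffError f n x| ≤ A / (s - 3) * (n : ℝ) ^ (3 - s) := by
  refine le_on_Icc_of_le_on_Ioo (continuousOn_chebDiffError hf n).abs (fun y hy => ?_) x hx
  have := abs_chebDiffError_le hf (r := 1) (p := 2) (M := 1) le_rfl (by norm_num) (by linarith) ha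
    (fun k y hy => by
      rw [one_mul]
      exact abs_eval_derivative_T_le_sq k (abs_le.2 ⟨hy.1.le, hy.2.le⟩)) hy hn
  convert this using 2
  · rw [abs_one, mul_one]; congr 1; ring
  · congr 1; ring

end ChebyshevDerivative

/-! ### Gaining a factor `n` by multiplication with `x - ξ` -/

section MulLinear

variable {f : ℝ → ℝ} {ξ : ℝ}

lemma chebCoeff_sub_mul_zero (hf : ContinuousOn f (Icc (-1) 1)) (ξ : ℝ) :
    chebCoeff (fun x => (x - ξ) * f x) 0 = chebCoeff f 1 - ξ * chebCoeff f 0 := by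
  have hc := continuous_comp_cos hf
  have hi : ∀ k : ℕ, IntervalIntegrable (fun θ => f (Real.cos θ) * Real.cos (k * θ))
      MeasureTheory.volume 0 Real.pi := fun k =>
    (hc.mul (by fun_prop)).intervalIntegrable _ _
  simp only [chebCoeff_eq_integral_cos]
  have e : ∀ θ : ℝ, (Real.cos θ - ξ) * f (Real.cos θ) * Real.cos ((0 : ℕ) * θ) =
      f (Real.cos θ) * Real.cos ((1 : ℕ) * θ) - ξ * (f (Real.cos θ) * Real.cos ((0 : ℕ) * θ)) := by
    intro θ; simp; ring
  simp_rw [e]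
  rw [intervalIntegral.integral_sub (hi 1) ((hi 0).const_mul ξ),
    intervalIntegral.integral_const_mul]
  ring

lemma chebCoeff_sub_mul_succ (hf : ContinuousOn f (Icc (-1) 1)) (ξ : ℝ) (k : ℕ) :
    chebCoeff (fun x => (x - ξ) * f x) (k + 1) =
      (chebCoeff f (k + 2) + chebCoeff f k) / 2 - ξ * chebCoeff f (k + 1) := by
  have hc := continuous_comp_cos hf
  have hi : ∀ k : ℕ, IntervalIntegrable (fun θ => f (Real.cos θ) * Real.cos (k * θ))
      MeasureTheory.volume 0 Real.pi := fun k =>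
    (hc.mul (by fun_prop)).intervalIntegrable _ _
  simp only [chebCoeff_eq_integral_cos]
  have e : ∀ θ : ℝ, (Real.cos θ - ξ) * f (Real.cos θ) * Real.cos ((k + 1 : ℕ) * θ) =
      (f (Real.cos θ) * Real.cos ((k + 2 : ℕ) * θ) + f (Real.cos θ) * Real.cos (k * θ)) / 2 -
        ξ * (f (Real.cos θ) * Real.cos ((k + 1 : ℕ) * θ)) := by
    intro θ
    have h1 : ((k + 2 : ℕ) : ℝ) * θ = ((k + 1 : ℕ) : ℝ) * θ + θ := by push_cast; ring
    have h2 : (k : ℝ) * θ = ((k + 1 : ℕ) : ℝ) * θ - θ := by push_cast; ring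
    rw [h1, h2, Real.cos_add, Real.cos_sub]
    ring
  simp_rw [e]
  rw [intervalIntegral.integral_sub (((hi _).add (hi k)).div_const 2) ((hi _).const_mul ξ),
    intervalIntegral.integral_const_mul, intervalIntegral.integral_div,
    intervalIntegral.integral_add (hi _) (hi k)]
  ring

/-- Multiplication by `x` shifts the index by one in both directions, so truncation and
multiplication commute except at the cutoff. -/
lemma sub_mul_chebProj (hf : ContinuousOn f (Icc (-1) 1)) (ξ : ℝ) (n : ℕ) :
    (X - C ξ) * chebProj f n = chebProj (fun x => (x - ξ) * f x) n +
      C (chebCoeff f n / 2) * Chebyshev.T ℝ ((n + 1 : ℕ) : ℤ) -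
      C (chebCoeff f (n + 1) / 2) * Chebyshev.T ℝ (n : ℤ) := by
  refine Polynomial.funext fun x => ?_
  simp only [eval_mul, eval_sub, eval_X, eval_C, eval_add]
  induction n with
  | zero => simp [eval_chebProj, chebCoeff_sub_mul_zero hf]; ring
  | succ n ih =>
    have hT : (Chebyshev.T ℝ ((n + 1 + 1 : ℕ) : ℤ)).eval x =
        2 * x * (Chebyshev.T ℝ ((n + 1 : ℕ) : ℤ)).eval x - (Chebyshev.T ℝ (n : ℤ)).eval x := by
      rw [show ((n + 1 + 1 : ℕ) : ℤ) = (n : ℤ) + 2 by push_cast; ring, Chebyshev.T_add_two]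
      simp
    rw [chebProj_succ, chebProj_succ, mul_add, ih, chebCoeff_sub_mul_succ hf, hT]
    ring

lemma contDiffOn_sub_mul (hf : ContDiffOn ℝ 1 f (Icc (-1) 1)) (ξ : ℝ) :
    ContDiffOn ℝ 1 (fun x => (x - ξ) * f x) (Icc (-1) 1) :=
  (contDiffOn_id.sub contDiffOn_const).mul hf

lemma sub_mul_chebDiffError (hf : ContDiffOn ℝ 1 f (Icc (-1) 1)) (ξ : ℝ) (n : ℕ) {x : ℝ}
    (hx : x ∈ Icc (-1 : ℝ) 1) :
    (x - ξ) * chebDiffError f n x = chebDiffError (fun x => (x - ξ) * f x) n x -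
      (f x - (chebProj f n).eval x) -
      (chebCoeff f n / 2 * (derivative (Chebyshev.T ℝ ((n + 1 : ℕ) : ℤ))).eval x -
        chebCoeff f (n + 1) / 2 * (derivative (Chebyshev.T ℝ (n : ℤ))).eval x) := by
  have h1 := congrArg (fun p : ℝ[X] => (derivative p).eval x)
    (sub_mul_chebProj hf.continuousOn ξ n)
  simp only [derivative_mul, derivative_sub, derivative_X, derivative_C, derivative_add,
    eval_add, eval_sub, eval_mul, eval_X, eval_C, sub_zero, zero_mul, zero_add, one_mul] at h1
  have h2 : derivWithin (fun x => (x - ξ) * f x) (Icc (-1) 1) x =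
      f x + (x - ξ) * derivWithin f (Icc (-1) 1) x := by
    have := ((hasDerivAt_id' x).sub_const ξ |>.hasDerivWithinAt (s := Icc (-1) 1)).fun_mul
      (hf.differentiableOn (by simp) x hx).hasDerivWithinAt
    simpa using this.derivWithin (uniqueDiffOn_Icc (by norm_num) x hx)
  rw [chebDiffError, chebDiffError, h2]
  linear_combination -h1

/-- Only the series of `(x - ξ) f` is differentiated termwise, which needs `p < ρ + 1`. For `p = 2`
this is `ρ > 1`, whereas the series of `f` itself would require `ρ > 2`. -/
lemma abs_sub_mul_chebDiffError_le (hf : ContDiffOn ℝ 1 f (Icc (-1) 1)) {A B ρ p M r : ℝ}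
    (hr : r ≤ 1) (hp : 1 ≤ p) (hρ : p < ρ + 1)
    (ha : ∀ k : ℕ, 1 ≤ k → |chebCoeff f k| ≤ A * (k : ℝ) ^ (-(ρ + 1)))
    (hb : ∀ k : ℕ, 1 ≤ k → |chebCoeff (fun x => (x - ξ) * f x) k| ≤ B * (k : ℝ) ^ (-(ρ + 2)))
    (hT : ∀ k : ℕ, ∀ y ∈ Ioo (-r) r,
      |(derivative (Chebyshev.T ℝ (k : ℤ))).eval y| ≤ M * (k : ℝ) ^ p) :
    ∃ K, ∀ n : ℕ, 1 ≤ n → ∀ x ∈ Ioo (-r) r,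
      |(x - ξ) * chebDiffError f n x| ≤ K * (n : ℝ) ^ (p - 1 - ρ) := by
  have hA := nonneg_of_abs_le_rpow ha
  have hρ0 : 0 < ρ := by linarith
  refine ⟨B * |M| / (ρ + 2 - p - 1) + A / ρ + (A / 2 * (|M| * 2 ^ p) + A / 2 * |M|),
    fun n hn x hx => ?_⟩
  have hn0 : (0 : ℝ) < n := by exact_mod_cast hn
  have hn1 : (1 : ℝ) ≤ n := by exact_mod_cast hn
  have hx1 : x ∈ Icc (-1 : ℝ) 1 := ⟨by linarith [hx.1], by linarith [hx.2]⟩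
  have e1 := abs_chebDiffError_le (contDiffOn_sub_mul hf ξ) hr (by linarith) (by linarith) hb hT
    hx hn
  rw [show 1 + p - (ρ + 2) = p - 1 - ρ by ring] at e1
  have e2 := abs_sub_chebProj_le hf.continuousOn (by linarith) ha hx1 hn
  have e2' : |f x - (chebProj f n).eval x| ≤ A / ρ * (n : ℝ) ^ (p - 1 - ρ) := by
    refine e2.trans ?_
    rw [add_sub_cancel_right]
    refine mul_le_mul_of_nonneg_left (Real.rpow_le_rpow_of_exponent_le hn1 ?_) (by positivity)
    linarith
  have hpow : (n : ℝ) ^ (-(ρ + 1)) * (n : ℝ) ^ p = (n : ℝ) ^ (p - 1 - ρ) := by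
    rw [← Real.rpow_add hn0]; ring_nf
  have e3 : |chebCoeff f n / 2 * (derivative (Chebyshev.T ℝ ((n + 1 : ℕ) : ℤ))).eval x| ≤
      A / 2 * (|M| * 2 ^ p) * (n : ℝ) ^ (p - 1 - ρ) := by
    -- The factor `2 ^ p` pays for replacing `n + 1` by `2 n`.
    have h1 : |(derivative (Chebyshev.T ℝ ((n + 1 : ℕ) : ℤ))).eval x| ≤
        |M| * (2 ^ p * (n : ℝ) ^ p) := by
      refine (hT _ x hx).trans ?_
      rw [← Real.mul_rpow (by norm_num) hn0.le]
      gcongr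
      · exact le_abs_self M
      · push_cast; linarith
    rw [abs_mul, abs_div, abs_two, ← hpow]
    calc _ ≤ A * (n : ℝ) ^ (-(ρ + 1)) / 2 * (|M| * (2 ^ p * (n : ℝ) ^ p)) := by
          refine mul_le_mul ?_ h1 (abs_nonneg _) (by positivity)
          gcongr
          exact ha n hn
      _ = _ := by ring
  have e4 : |chebCoeff f (n + 1) / 2 * (derivative (Chebyshev.T ℝ (n : ℤ))).eval x| ≤
      A / 2 * |M| * (n : ℝ) ^ (p - 1 - ρ) := by
    have h1 : |(derivative (Chebyshev.T ℝ (n : ℤ))).eval x| ≤ |M| * (n : ℝ) ^ p := by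
      refine (hT _ x hx).trans ?_
      gcongr
      exact le_abs_self M
    have h2 : |chebCoeff f (n + 1)| ≤ A * (n : ℝ) ^ (-(ρ + 1)) := by
      refine (ha _ (by omega)).trans ?_
      refine mul_le_mul_of_nonneg_left ?_ hA
      exact Real.rpow_le_rpow_of_nonpos hn0 (by push_cast; linarith) (by linarith)
    rw [abs_mul, abs_div, abs_two, ← hpow]
    calc _ ≤ A * (n : ℝ) ^ (-(ρ + 1)) / 2 * (|M| * (n : ℝ) ^ p) := by
          refine mul_le_mul ?_ h1 (abs_nonneg _) (by positivity)
          gcongr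
      _ = _ := by ring
  rw [sub_mul_chebDiffError hf ξ n hx1]
  calc _ ≤ _ := (abs_sub _ _).trans (add_le_add (abs_sub _ _) (abs_sub _ _))
    _ ≤ _ := add_le_add (add_le_add e1 e2') (add_le_add e3 e4)
    _ = _ := by ring

/-- Away from the zero of `x - ξ`, the error at a fixed interior point decays faster by `1 / n`. -/
lemma abs_chebDiffError_le_of_ne (hf : ContDiffOn ℝ 1 f (Icc (-1) 1)) {A B ρ : ℝ} (hρ : 1 < ρ)
    (ha : ∀ k : ℕ, 1 ≤ k → |chebCoeff f k| ≤ A * (k : ℝ) ^ (-(ρ + 1)))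
    (hb : ∀ k : ℕ, 1 ≤ k → |chebCoeff (fun x => (x - ξ) * f x) k| ≤ B * (k : ℝ) ^ (-(ρ + 2)))
    {x : ℝ} (hx : x ∈ Ioo (-1 : ℝ) 1) (hxξ : x ≠ ξ) :
    ∃ K, ∀ n : ℕ, 1 ≤ n → |chebDiffError f n x| ≤ K * (n : ℝ) ^ (-ρ) := by
  have hx1 : |x| < 1 := abs_lt.2 hx
  set r := (|x| + 1) / 2 with hr
  have hxr : x ∈ Ioo (-r) r := abs_lt.1 (by linarith)
  obtain ⟨K, hK⟩ := abs_sub_mul_chebDiffError_le hf (r := r) (by linarith) le_rfl (by linarith)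
    ha hb (fun k y hy => abs_eval_derivative_T_le_mul k (by linarith) hy)
  have h0 : 0 < |x - ξ| := abs_pos.2 (sub_ne_zero.2 hxξ)
  refine ⟨K / |x - ξ|, fun n hn => ?_⟩
  have := hK n hn x hxr
  rw [abs_mul, sub_self, zero_sub] at this
  rw [div_mul_eq_mul_div, le_div_iff₀ h0]
  linarith

lemma abs_sub_mul_chebDiffError_le_of_mem_Icc (hf : ContDiffOn ℝ 1 f (Icc (-1) 1)) {A B ρ : ℝ}
    (hρ : 1 < ρ) (ha : ∀ k : ℕ, 1 ≤ k → |chebCoeff f k| ≤ A * (k : ℝ) ^ (-(ρ + 1)))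
    (hb : ∀ k : ℕ, 1 ≤ k → |chebCoeff (fun x => (x - ξ) * f x) k| ≤ B * (k : ℝ) ^ (-(ρ + 2))) :
    ∃ K, ∀ n : ℕ, 1 ≤ n → ∀ x ∈ Icc (-1 : ℝ) 1,
      |(x - ξ) * chebDiffError f n x| ≤ K * (n : ℝ) ^ (1 - ρ) := by
  obtain ⟨K, hK⟩ := abs_sub_mul_chebDiffError_le hf (r := 1) (p := 2) (M := 1) le_rfl
    (by norm_num) (by linarith) ha hb (fun k y hy => by
      rw [one_mul]
      exact abs_eval_derivative_T_le_sq k (abs_le.2 ⟨hy.1.le, hy.2.le⟩))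
  rw [show (2 : ℝ) - 1 - ρ = 1 - ρ by ring] at hK
  exact ⟨K, fun n hn => le_on_Icc_of_le_on_Ioo
    (((continuous_id.sub continuous_const).continuousOn.mul
      (continuousOn_chebDiffError hf n)).abs) (hK n hn)⟩

/-- Uniform estimate on `[-1, 1]` for an interior `ξ`. -/
lemma abs_chebDiffError_le_uniform (hf : ContDiffOn ℝ 1 f (Icc (-1) 1)) {A B ρ : ℝ}
    (hρ : 1 < ρ) (hξ : ξ ∈ Ioo (-1 : ℝ) 1)
    (ha : ∀ k : ℕ, 1 ≤ k → |chebCoeff f k| ≤ A * (k : ℝ) ^ (-(ρ + 1)))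
    (hb : ∀ k : ℕ, 1 ≤ k → |chebCoeff (fun x => (x - ξ) * f x) k| ≤ B * (k : ℝ) ^ (-(ρ + 2))) :
    ∃ K, ∀ n : ℕ, 1 ≤ n → ∀ x ∈ Icc (-1 : ℝ) 1,
      |chebDiffError f n x| ≤ K * (n : ℝ) ^ (1 - ρ) := by
  obtain ⟨K, hK⟩ := abs_sub_mul_chebDiffError_le_of_mem_Icc hf hρ ha hb
  have hξ1 : |ξ| < 1 := abs_lt.2 hξ
  set r := (|ξ| + 1) / 2 with hr
  set K' := A * |1 / √(1 - r ^ 2)| / (ρ + 1 - 1 - 1) with hK'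
  refine ⟨max (K / (r - |ξ|)) K', fun n hn x hx => ?_⟩
  have hn0 : 0 ≤ (n : ℝ) ^ (1 - ρ) := Real.rpow_nonneg (Nat.cast_nonneg _) _
  -- Near `ξ` the interior bound `T_k' = O(k)` is enough; for `|x| ≥ r` the factor `|x - ξ|` is at
  -- least `r - |ξ|` and can be divided out.
  rcases lt_or_ge |x| r with hxr | hxr
  · have := abs_chebDiffError_le hf (r := r) (by linarith) zero_le_one (by linarith) ha
      (fun k y hy => abs_eval_derivative_T_le_mul k (by linarith) hy) (abs_lt.1 hxr) hn
    rw [show 1 + 1 - (ρ + 1) = 1 - ρ by ring] at this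
    exact this.trans (mul_le_mul_of_nonneg_right (le_max_right _ _) hn0)
  · have h1 : r - |ξ| ≤ |x - ξ| := by linarith [abs_sub_abs_le_abs_sub x ξ]
    have h0 : 0 < r - |ξ| := by linarith
    refine le_trans ?_ (mul_le_mul_of_nonneg_right (le_max_left _ _) hn0)
    have h2 := hK n hn x hx
    rw [abs_mul] at h2
    rw [div_mul_eq_mul_div, le_div_iff₀ h0]
    nlinarith [mul_le_mul_of_nonneg_right h1 (abs_nonneg (chebDiffError f n x))]

end MulLinear

/-! ### Coefficient decay for the model function -/

section ModelFunction

lemma mul_pi_sub_le_sin {y : ℝ} (h0 : 0 ≤ y) (h1 : y ≤ Real.pi) :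
    2 / Real.pi ^ 2 * (y * (Real.pi - y)) ≤ Real.sin y := by
  have hπ := Real.pi_pos
  have key : ∀ z : ℝ, 0 ≤ z → z ≤ Real.pi / 2 →
      2 / Real.pi ^ 2 * (z * (Real.pi - z)) ≤ Real.sin z := by
    intro z hz0 hz
    refine le_trans ?_ (Real.mul_le_sin hz0 hz)
    have : 2 / Real.pi * z = 2 / Real.pi ^ 2 * (z * Real.pi) := by field_simp
    rw [this]
    gcongr
    linarith
  rcases le_total y (Real.pi / 2) with h | h
  · exact key y h0 h
  · have := key (Real.pi - y) (by linarith) (by linarith)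
    rw [Real.sin_pi_sub] at this
    convert this using 2
    ring

/-- Powers of the half-angle sine are symbols on a full turn. -/
lemma arcSymbol_sin_half_rpow (a γ : ℝ) (N : ℕ) :
    ArcSymbol a (a + 2 * Real.pi) N γ (fun θ => Real.sin ((θ - a) / 2) ^ γ) := by
  have hπ := Real.pi_pos
  have h1 : ArcSymbol a (a + 2 * Real.pi) (N + 1) 1 (fun θ => Real.sin ((θ - a) / 2)) :=
    ArcSymbol.of_contDiff_of_vanish (by fun_prop) (by simp) (by simp)
  refine h1.of_succ.rpow (c := 1 / (2 * Real.pi ^ 2)) (by positivity) (fun θ hθ => ?_) γ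
  refine le_of_eq_of_le ?_ (mul_pi_sub_le_sin (y := (θ - a) / 2) (by linarith [hθ.1])
    (by linarith [hθ.2]))
  field_simp
  ring

/-- Powers of the function vanishing at both ends of a proper arc are symbols. -/
lemma arcSymbol_sin_mul_sin_rpow {a b : ℝ} (hab : b - a < 2 * Real.pi) (γ : ℝ) (N : ℕ) :
    ArcSymbol a b N γ (fun θ => (2 * (Real.sin ((θ - a) / 2) * Real.sin ((b - θ) / 2))) ^ γ) := by
  have hπ := Real.pi_pos
  have h1 : ArcSymbol a b (N + 1) 1
      (fun θ => 2 * (Real.sin ((θ - a) / 2) * Real.sin ((b - θ) / 2))) :=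
    ArcSymbol.of_contDiff_of_vanish (by fun_prop) (by simp) (by simp)
  have hd : 0 < Real.pi - (b - a) / 2 := by linarith
  refine h1.of_succ.rpow
    (c := 2 * (1 / Real.pi ^ 2 * (Real.pi - (b - a) / 2)) ^ 2) (by positivity) (fun θ hθ => ?_) γ
  -- As the arc is shorter than a full turn, `π - y / 2` stays above a positive constant and `sin (y
  -- / 2)` is bounded below linearly.
  have key : ∀ y : ℝ, 0 < y → y < b - a →
      1 / Real.pi ^ 2 * (Real.pi - (b - a) / 2) * y ≤ Real.sin (y / 2) := by
    intro y hy hyb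
    refine le_trans ?_ (mul_pi_sub_le_sin (y := y / 2) (by linarith) (by linarith))
    have : 1 / Real.pi ^ 2 * (Real.pi - (b - a) / 2) * y =
        2 / Real.pi ^ 2 * (y / 2 * (Real.pi - (b - a) / 2)) := by ring
    rw [this]
    gcongr
  have k1 := key (θ - a) (sub_pos.2 hθ.1) (by linarith [hθ.2])
  have k2 := key (b - θ) (sub_pos.2 hθ.2) (by linarith [hθ.1])
  have q1 : 0 < θ - a := sub_pos.2 hθ.1
  have q2 : 0 < b - θ := sub_pos.2 hθ.2
  calc _ = 2 * ((1 / Real.pi ^ 2 * (Real.pi - (b - a) / 2) * (θ - a)) *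
        (1 / Real.pi ^ 2 * (Real.pi - (b - a) / 2) * (b - θ))) := by ring
    _ ≤ _ := by
      have q3 : 0 ≤ Real.sin ((θ - a) / 2) := le_trans (by positivity) k1
      gcongr

variable {ξ α : ℝ} {g : ℝ → ℝ}

lemma arccos_mem_Ioo (hξ : ξ ∈ Ioo (-1 : ℝ) 1) : Real.arccos ξ ∈ Ioo 0 Real.pi :=
  ⟨Real.arccos_pos.2 hξ.2, Real.arccos_lt_pi.2 hξ.1⟩

lemma arcSymbol_abs_cos_sub_left (hξ : ξ ∈ Ioo (-1 : ℝ) 1) (γ : ℝ) (N : ℕ) :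
    ArcSymbol (-Real.arccos ξ) (Real.arccos ξ) N γ (fun θ => |Real.cos θ - ξ| ^ γ) := by
  have h0 := arccos_mem_Ioo hξ
  refine (arcSymbol_sin_mul_sin_rpow (a := -Real.arccos ξ) (b := Real.arccos ξ)
    (by linarith [h0.2]) γ N).congr fun θ hθ => ?_
  have e : Real.cos θ - ξ = 2 * (Real.sin ((θ - -Real.arccos ξ) / 2) *
      Real.sin ((Real.arccos ξ - θ) / 2)) := by
    conv_lhs => rw [← Real.cos_arccos hξ.1.le hξ.2.le]
    rw [Real.cos_sub_cos, sub_neg_eq_add, ← neg_sub (Real.arccos ξ) θ, neg_div, Real.sin_neg]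
    ring
  have p1 : 0 < Real.sin ((θ - -Real.arccos ξ) / 2) :=
    Real.sin_pos_of_pos_of_lt_pi (by linarith [hθ.1]) (by linarith [hθ.2, h0.2])
  have p2 : 0 < Real.sin ((Real.arccos ξ - θ) / 2) :=
    Real.sin_pos_of_pos_of_lt_pi (by linarith [hθ.2]) (by linarith [hθ.1, h0.2])
  simp only [e]
  rw [abs_of_pos (by positivity)]

lemma arcSymbol_abs_cos_sub_right (hξ : ξ ∈ Ioo (-1 : ℝ) 1) (γ : ℝ) (N : ℕ) :
    ArcSymbol (Real.arccos ξ) (2 * Real.pi - Real.arccos ξ) N γ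
      (fun θ => |Real.cos θ - ξ| ^ γ) := by
  have h0 := arccos_mem_Ioo hξ
  refine (arcSymbol_sin_mul_sin_rpow (a := Real.arccos ξ) (b := 2 * Real.pi - Real.arccos ξ)
    (by linarith [h0.1]) γ N).congr fun θ hθ => ?_
  have e : Real.cos θ - ξ = -(2 * (Real.sin ((θ - Real.arccos ξ) / 2) *
      Real.sin ((2 * Real.pi - Real.arccos ξ - θ) / 2))) := by
    conv_lhs => rw [← Real.cos_arccos hξ.1.le hξ.2.le]
    rw [Real.cos_sub_cos, show (2 * Real.pi - Real.arccos ξ - θ) / 2 =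
      Real.pi - (θ + Real.arccos ξ) / 2 by ring, Real.sin_pi_sub]
    ring
  have p1 : 0 < Real.sin ((θ - Real.arccos ξ) / 2) :=
    Real.sin_pos_of_pos_of_lt_pi (by linarith [hθ.1]) (by linarith [hθ.2, h0.1])
  have p2 : 0 < Real.sin ((2 * Real.pi - Real.arccos ξ - θ) / 2) :=
    Real.sin_pos_of_pos_of_lt_pi (by linarith [hθ.2]) (by linarith [hθ.1, h0.1])
  simp only [e]
  rw [abs_neg, abs_of_pos (by positivity)]

/-- When `cos a = ±1`, `|cos θ - cos a| = 2 sin² ((θ - a) / 2)`: the double zero doubles the order.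
-/
lemma arcSymbol_abs_cos_sub_cos {a : ℝ} (ha : Real.sin a = 0) (γ : ℝ) (N : ℕ) :
    ArcSymbol a (a + 2 * Real.pi) N (2 * γ) (fun θ => |Real.cos θ - Real.cos a| ^ γ) := by
  refine ((arcSymbol_sin_half_rpow a (2 * γ) N).const_mul (2 ^ γ)).congr fun θ hθ => ?_
  have p : 0 < Real.sin ((θ - a) / 2) :=
    Real.sin_pos_of_pos_of_lt_pi (by linarith [hθ.1]) (by linarith [hθ.2])
  have e : |Real.cos θ - Real.cos a| = 2 * Real.sin ((θ - a) / 2) ^ (2 : ℝ) := by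
    have h1 : Real.cos (θ - a) = Real.cos θ * Real.cos a := by
      rw [Real.cos_sub, ha]; ring
    have h2 : Real.sin ((θ - a) / 2) ^ 2 = 1 / 2 - Real.cos (θ - a) / 2 := by
      rw [Real.sin_sq_eq_half_sub]; congr 3; ring
    rw [Real.rpow_two, h2, h1]
    have h3 : (Real.cos a - 1) * (Real.cos a + 1) = 0 := by
      have := Real.sin_sq_add_cos_sq a
      rw [ha] at this; linarith
    rcases mul_eq_zero.1 h3 with h | h
    · rw [show Real.cos a = 1 by linarith, abs_of_nonpos (by linarith [Real.cos_le_one θ])]; ring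
    · rw [show Real.cos a = -1 by linarith, abs_of_nonneg (by linarith [Real.neg_one_le_cos θ])]
      ring
  simp only [e]
  rw [Real.mul_rpow (by norm_num) (by positivity), ← Real.rpow_mul p.le]

lemma contDiff_comp_cos {n : ℕ} (hg : ContDiffOn ℝ n g (Icc (-1) 1)) :
    ContDiff ℝ n (fun θ => g (Real.cos θ)) :=
  hg.comp_contDiff Real.contDiff_cos fun θ => ⟨Real.neg_one_le_cos θ, Real.cos_le_one θ⟩

lemma arcSymbol_modelFun {a b γ : ℝ} {N : ℕ} (hg : ContDiffOn ℝ N g (Icc (-1) 1))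
    (h : ArcSymbol a b N γ (fun θ => |Real.cos θ - ξ| ^ α)) :
    ArcSymbol a b N γ (fun θ => modelFun ξ α g (Real.cos θ)) := by
  have := h.mul (ArcSymbol.of_contDiff (a := a) (b := b) (contDiff_comp_cos hg))
  rwa [add_zero] at this

lemma arcSymbol_sub_mul_modelFun {a b γ : ℝ} {N : ℕ}
    (hg : ContDiffOn ℝ (N + 1 : ℕ) g (Icc (-1) 1))
    (ha : Real.cos a = ξ) (hb : Real.cos b = ξ)
    (h : ArcSymbol a b (N + 1) γ (fun θ => |Real.cos θ - ξ| ^ α)) :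
    ArcSymbol a b (N + 1) (γ + 1) (fun θ => (Real.cos θ - ξ) * modelFun ξ α g (Real.cos θ)) := by
  have h1 : ArcSymbol a b (N + 1) 1 (fun θ => Real.cos θ - ξ) :=
    ArcSymbol.of_contDiff_of_vanish (Real.contDiff_cos.sub contDiff_const) (by simp [ha])
      (by simp [hb])
  have := h1.mul (arcSymbol_modelFun hg h)
  rwa [add_comm 1 γ] at this

lemma abs_chebCoeff_le_of_arcSymbol {f : ℝ → ℝ} (hf : ContinuousOn f (Icc (-1) 1)) {a γ : ℝ}
    {N : ℕ} (hγ : 0 ≤ γ) (hN : γ + 1 < N)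
    (h : ArcSymbol a (a + 2 * Real.pi) N γ (fun θ => f (Real.cos θ))) :
    ∃ K, ∀ k : ℕ, 1 ≤ k → |chebCoeff f k| ≤ K * (k : ℝ) ^ (-(γ + 1)) := by
  have hπ := Real.pi_pos
  obtain ⟨K, hK⟩ := ArcSymbol.abs_integral_mul_cos_le (by linarith) h hN hγ (continuous_comp_cos hf)
  refine ⟨K / Real.pi, fun k hk => ?_⟩
  have h1 := hK k 0 (by exact_mod_cast hk)
  simp only [add_zero] at h1
  rw [integral_period_comp_cos_mul_cos hf, abs_mul, abs_of_pos hπ,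
    show -γ - 1 = -(γ + 1) by ring] at h1
  rw [div_mul_eq_mul_div, le_div_iff₀ hπ]
  linarith

/-- For an interior `ξ` the circle is cut at both preimages `±arccos ξ`, and each arc is estimated
separately. -/
lemma abs_chebCoeff_le_of_arcSymbol_two {f : ℝ → ℝ} (hf : ContinuousOn f (Icc (-1) 1)) {a b γ : ℝ}
    {N : ℕ} (hab : a < b) (hba : b < a + 2 * Real.pi) (hγ : 0 ≤ γ) (hN : γ + 1 < N)
    (h : ArcSymbol a b N γ (fun θ => f (Real.cos θ)))
    (h' : ArcSymbol b (a + 2 * Real.pi) N γ (fun θ => f (Real.cos θ))) :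
    ∃ K, ∀ k : ℕ, 1 ≤ k → |chebCoeff f k| ≤ K * (k : ℝ) ^ (-(γ + 1)) := by
  have hπ := Real.pi_pos
  have hc := continuous_comp_cos hf
  obtain ⟨K, hK⟩ := ArcSymbol.abs_integral_mul_cos_le hab h hN hγ hc
  obtain ⟨L, hL⟩ := ArcSymbol.abs_integral_mul_cos_le hba h' hN hγ hc
  refine ⟨(K + L) / Real.pi, fun k hk => ?_⟩
  have h1 := hK k 0 (by exact_mod_cast hk)
  have h2 := hL k 0 (by exact_mod_cast hk)
  simp only [add_zero] at h1 h2
  have hi : ∀ p q, IntervalIntegrable (fun θ => f (Real.cos θ) * Real.cos (k * θ))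
      MeasureTheory.volume p q := fun p q => (hc.mul (by fun_prop)).intervalIntegrable _ _
  have h3 := integral_period_comp_cos_mul_cos hf k a
  rw [← intervalIntegral.integral_add_adjacent_intervals (hi a b) (hi _ _)] at h3
  have h4 : |Real.pi * chebCoeff f k| ≤ (K + L) * (k : ℝ) ^ (-(γ + 1)) := by
    rw [← h3, show -(γ + 1) = -γ - 1 by ring, add_mul]
    exact (abs_add_le _ _).trans (add_le_add h1 h2)
  rw [abs_mul, abs_of_pos hπ] at h4
  rw [div_mul_eq_mul_div, le_div_iff₀ hπ]
  linarith

lemma contDiffOn_modelFun (hα : 1 < α) (ξ : ℝ) (hg : ContDiffOn ℝ 1 g (Icc (-1) 1)) :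
    ContDiffOn ℝ 1 (modelFun ξ α g) (Icc (-1) 1) := by
  have h := (contDiff_norm_rpow (E := ℝ) hα).comp (contDiff_id.sub (contDiff_const (c := ξ)))
  exact h.contDiffOn.mul hg

lemma chebCoeff_modelFun_interior (hα : 1 < α) (hξ : ξ ∈ Ioo (-1 : ℝ) 1) {N : ℕ}
    (hN : α + 1 < N) (hg : ContDiffOn ℝ (N + 1 : ℕ) g (Icc (-1) 1)) :
    (∃ A, ∀ k : ℕ, 1 ≤ k → |chebCoeff (modelFun ξ α g) k| ≤ A * (k : ℝ) ^ (-(α + 1))) ∧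
    ∃ B, ∀ k : ℕ, 1 ≤ k →
      |chebCoeff (fun x => (x - ξ) * modelFun ξ α g x) k| ≤ B * (k : ℝ) ^ (-(α + 2)) := by
  have h0 := arccos_mem_Ioo hξ
  have hf := contDiffOn_modelFun hα ξ (hg.of_le (by norm_cast; omega))
  have e : -Real.arccos ξ + 2 * Real.pi = 2 * Real.pi - Real.arccos ξ := by ring
  have c1 : Real.cos (Real.arccos ξ) = ξ := Real.cos_arccos hξ.1.le hξ.2.le
  have c2 : Real.cos (-Real.arccos ξ) = ξ := by rw [Real.cos_neg, c1]
  have c3 : Real.cos (2 * Real.pi - Real.arccos ξ) = ξ := by rw [Real.cos_two_pi_sub, c1]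
  have hl := arcSymbol_abs_cos_sub_left hξ α (N + 1)
  have hr := arcSymbol_abs_cos_sub_right hξ α (N + 1)
  constructor
  · refine abs_chebCoeff_le_of_arcSymbol_two (a := -Real.arccos ξ) (b := Real.arccos ξ) (N := N + 1)
      hf.continuousOn (by linarith [h0.1]) (by linarith [h0.2]) (by linarith)
      (by push_cast; linarith) (arcSymbol_modelFun hg hl) ?_
    rw [e]
    exact arcSymbol_modelFun hg hr
  · rw [show α + 2 = α + 1 + 1 by ring]
    refine abs_chebCoeff_le_of_arcSymbol_two (a := -Real.arccos ξ) (b := Real.arccos ξ) (N := N + 1)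
      (contDiffOn_sub_mul hf ξ).continuousOn (by linarith [h0.1]) (by linarith [h0.2])
      (by linarith) (by push_cast; linarith) (arcSymbol_sub_mul_modelFun hg c2 c1 hl) ?_
    rw [e]
    exact arcSymbol_sub_mul_modelFun hg c1 c3 hr

lemma chebCoeff_modelFun_endpoint (hα : 1 < α) (hξ : ξ = 1 ∨ ξ = -1) {N : ℕ}
    (hN : 2 * α + 1 < N) (hg : ContDiffOn ℝ (N + 1 : ℕ) g (Icc (-1) 1)) :
    (∃ A, ∀ k : ℕ, 1 ≤ k → |chebCoeff (modelFun ξ α g) k| ≤ A * (k : ℝ) ^ (-(2 * α + 1))) ∧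
    ∃ B, ∀ k : ℕ, 1 ≤ k →
      |chebCoeff (fun x => (x - ξ) * modelFun ξ α g x) k| ≤ B * (k : ℝ) ^ (-(2 * α + 2)) := by
  have hf := contDiffOn_modelFun hα ξ (hg.of_le (by norm_cast; omega))
  obtain ⟨a, ha, rfl⟩ : ∃ a, Real.sin a = 0 ∧ Real.cos a = ξ := by
    rcases hξ with rfl | rfl
    · exact ⟨0, by simp⟩
    · exact ⟨Real.pi, by simp⟩
  have h := arcSymbol_abs_cos_sub_cos ha α (N + 1)
  constructor
  · exact abs_chebCoeff_le_of_arcSymbol (N := N + 1) hf.continuousOn (by linarith)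
      (by push_cast; linarith) (arcSymbol_modelFun hg h)
  · rw [show 2 * α + 2 = 2 * α + 1 + 1 by ring]
    exact abs_chebCoeff_le_of_arcSymbol (N := N + 1) (contDiffOn_sub_mul hf _).continuousOn
      (by linarith) (by push_cast; linarith)
      (arcSymbol_sub_mul_modelFun hg rfl (Real.cos_add_two_pi a) h)

end ModelFunction

/-! ### Transfer of tail decay through a three-term recurrence -/

section Recurrence

/-- Every null sequence `E` with `E n - E (n + 1) = (n + 1) * u (n + 1)`, that is the sequence of
tails of `∑ k * u k`, is `O(n ^ (-α))`. -/
def TailDecay (α : ℝ) (u : ℕ → ℝ) : Prop :=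
  ∀ E : ℕ → ℝ, (∀ n, E n - E (n + 1) = ((n + 1 : ℕ) : ℝ) * u (n + 1)) → Tendsto E atTop (nhds 0) →
    ∃ K, ∀ n : ℕ, 1 ≤ n → |E n| ≤ K * (n : ℝ) ^ (-α)

variable {α A c : ℝ} {u v : ℕ → ℝ}

lemma tailDecay_of_abs_le (hα : 0 < α) (hu : ∀ k : ℕ, 1 ≤ k → |u k| ≤ A * (k : ℝ) ^ (-(α + 2))) :
    TailDecay α u := by
  intro E hE h0
  refine ⟨A / (α + 1 - 1), fun n hn => ?_⟩
  have := abs_le_of_abs_sub_succ_le (s := α + 1) (by linarith) (nonneg_of_abs_le_rpow hu) h0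
    (fun n _ => ?_) n hn
  · rwa [show 1 - (α + 1) = -α by ring] at this
  · have hp : (0 : ℝ) < ((n + 1 : ℕ) : ℝ) := by positivity
    rw [hE, abs_mul, Nat.abs_cast]
    calc _ ≤ ((n + 1 : ℕ) : ℝ) * (A * ((n + 1 : ℕ) : ℝ) ^ (-(α + 2))) := by
          gcongr
          exact hu _ (by omega)
      _ = A * (((n + 1 : ℕ) : ℝ) ^ (-(α + 2)) * ((n + 1 : ℕ) : ℝ) ^ (1 : ℝ)) := by
          rw [Real.rpow_one]; ring
      _ = _ := by rw [← Real.rpow_add hp]; ring_nf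

lemma mul_abs_le_rpow (hu : ∀ k : ℕ, 1 ≤ k → |u k| ≤ A * (k : ℝ) ^ (-(α + 1))) {n : ℕ}
    (hn : 1 ≤ n) : (n : ℝ) * |u n| ≤ A * (n : ℝ) ^ (-α) := by
  have hn0 : (0 : ℝ) < n := by exact_mod_cast hn
  have e : (n : ℝ) ^ (-α) = (n : ℝ) * (n : ℝ) ^ (-(α + 1)) := by
    rw [show -α = -(α + 1) + 1 by ring, Real.rpow_add_one hn0.ne']; ring_nf
  rw [e]
  nlinarith [hu n hn]

lemma abs_boundary_le (hα : 0 < α) (hu : ∀ k : ℕ, 1 ≤ k → |u k| ≤ A * (k : ℝ) ^ (-(α + 1)))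
    {n : ℕ} (hn : 1 ≤ n) :
    |(((n + 1 : ℕ) : ℝ) * u n - n * u (n + 1)) / 2| ≤ 2 * A * (n : ℝ) ^ (-α) := by
  have hA := nonneg_of_abs_le_rpow hu
  have hn0 : (0 : ℝ) < n := by exact_mod_cast hn
  have hn1 : (1 : ℝ) ≤ n := by exact_mod_cast hn
  have h1 := mul_abs_le_rpow hu hn
  have h2 := mul_abs_le_rpow hu (n := n + 1) (by omega)
  have h3 : A * ((n + 1 : ℕ) : ℝ) ^ (-α) ≤ A * (n : ℝ) ^ (-α) :=
    mul_le_mul_of_nonneg_left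
      (Real.rpow_le_rpow_of_nonpos hn0 (by push_cast; linarith) (by linarith)) hA
  have h4 : |((n + 1 : ℕ) : ℝ) * u n - n * u (n + 1)| ≤
      ((n + 1 : ℕ) : ℝ) * |u n| + n * |u (n + 1)| := by
    refine (abs_sub _ _).trans_eq ?_
    rw [abs_mul, abs_mul, Nat.abs_cast, Nat.abs_cast]
  have h5 : ((n + 1 : ℕ) : ℝ) * |u n| ≤ 2 * (n * |u n|) := by
    push_cast
    nlinarith [abs_nonneg (u n)]
  have h6 : (n : ℝ) * |u (n + 1)| ≤ ((n + 1 : ℕ) : ℝ) * |u (n + 1)| := by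
    push_cast
    nlinarith [abs_nonneg (u (n + 1))]
  have h7 : 0 ≤ A * (n : ℝ) ^ (-α) := by positivity
  rw [abs_div, abs_two, div_le_iff₀ two_pos]
  linarith

lemma tendsto_rpow_neg_nat (hα : 0 < α) (K : ℝ) :
    Tendsto (fun n : ℕ => K * (n : ℝ) ^ (-α)) atTop (nhds 0) := by
  have := ((tendsto_rpow_neg_atTop hα).comp tendsto_natCast_atTop_atTop).const_mul K
  rwa [mul_zero] at this

/-- Summation by parts: `k v_k` equals `(1 - c) k u_k` plus a telescoping difference whose boundary
term is `O(n ^ (-α))`. The constant `1 - c` is the value of `cos t - c` at `t = 0`. -/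
lemma TailDecay.of_recurrence (hα : 0 < α) (hc : c ≠ 1)
    (hu : ∀ k : ℕ, 1 ≤ k → |u k| ≤ A * (k : ℝ) ^ (-(α + 1)))
    (hv : ∀ k, v (k + 1) = (u (k + 2) + u k) / 2 - c * u (k + 1)) (h : TailDecay α v) :
    TailDecay α u := by
  intro E hE h0
  set D : ℕ → ℝ := fun n => (((n + 1 : ℕ) : ℝ) * u n - n * u (n + 1)) / 2 with hD
  have hD0 : Tendsto D atTop (nhds 0) := by
    refine squeeze_zero_norm' ?_ (tendsto_rpow_neg_nat hα (2 * A))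
    filter_upwards [eventually_ge_atTop 1] with n hn
    exact abs_boundary_le hα hu hn
  have hstep : ∀ n, ((1 - c) * E n + D n) - ((1 - c) * E (n + 1) + D (n + 1)) =
      ((n + 1 : ℕ) : ℝ) * v (n + 1) := by
    intro n
    rw [hv, hD]
    have := hE n
    push_cast at this ⊢
    linear_combination (1 - c) * this
  obtain ⟨K, hK⟩ := h (fun n => (1 - c) * E n + D n) hstep
    (by simpa using (h0.const_mul (1 - c)).add hD0)
  have hc0 : 0 < |1 - c| := abs_pos.2 (sub_ne_zero.2 hc.symm)
  refine ⟨(K + 2 * A) / |1 - c|, fun n hn => ?_⟩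
  have h1 := hK n hn
  have h2 := abs_boundary_le hα hu hn
  have h3 : |(1 - c) * E n| ≤ |(1 - c) * E n + D n| + |D n| := by
    have := abs_sub ((1 - c) * E n + D n) (D n)
    rwa [add_sub_cancel_right] at this
  rw [abs_mul] at h3
  rw [div_mul_eq_mul_div, le_div_iff₀ hc0]
  linarith

lemma abs_le_of_recurrence (hα : 0 < α)
    (hu : ∀ k : ℕ, 1 ≤ k → |u k| ≤ A * (k : ℝ) ^ (-(α + 1))) (hu0 : u 0 = 0)
    (hv : ∀ k, v (k + 1) = (u (k + 2) + u k) / 2 - c * u (k + 1)) :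
    ∃ B, ∀ k : ℕ, 1 ≤ k → |v k| ≤ B * (k : ℝ) ^ (-(α + 1)) := by
  have hA := nonneg_of_abs_le_rpow hu
  refine ⟨A + 2 ^ (α + 1) * A + |c| * A, fun k hk => ?_⟩
  obtain ⟨k, rfl⟩ : ∃ j, k = j + 1 := ⟨k - 1, by omega⟩
  have hp : (0 : ℝ) < ((k + 1 : ℕ) : ℝ) := by positivity
  set w := ((k + 1 : ℕ) : ℝ) ^ (-(α + 1)) with hw
  have hw0 : 0 < w := Real.rpow_pos_of_pos hp _
  have h1 : |u (k + 2)| ≤ A * w := by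
    refine (hu _ (by omega)).trans (mul_le_mul_of_nonneg_left ?_ hA)
    exact Real.rpow_le_rpow_of_nonpos hp (by push_cast; linarith) (by linarith)
  have h2 : |u k| ≤ 2 ^ (α + 1) * A * w := by
    -- The first term of `v` involves `u 0`, which the decay hypothesis does not cover; it vanishes
    -- for sine coefficients.
    rcases Nat.eq_zero_or_pos k with rfl | hk0
    · rw [hu0, abs_zero]; positivity
    · have hk1 : (1 : ℝ) ≤ k := by exact_mod_cast hk0
      have h3 : (k : ℝ) ^ (-(α + 1)) ≤ 2 ^ (α + 1) * w := by
        have e : (2 : ℝ) ^ (α + 1) = (2⁻¹ : ℝ) ^ (-(α + 1)) := by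
          rw [Real.inv_rpow (by norm_num), Real.rpow_neg (by norm_num), inv_inv]
        rw [e, hw, ← Real.mul_rpow (by norm_num) hp.le]
        exact Real.rpow_le_rpow_of_nonpos (by positivity) (by push_cast; linarith) (by linarith)
      calc _ ≤ A * (2 ^ (α + 1) * w) := (hu k hk0).trans (mul_le_mul_of_nonneg_left h3 hA)
        _ = _ := by ring
  have h3 : |c * u (k + 1)| ≤ |c| * A * w := by
    rw [abs_mul, mul_assoc]
    exact mul_le_mul_of_nonneg_left (hu _ (by omega)) (abs_nonneg c)
  have h4 : |(u (k + 2) + u k) / 2| ≤ A * w + 2 ^ (α + 1) * A * w := by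
    rw [abs_div, abs_two, div_le_iff₀ two_pos]
    have := abs_add_le (u (k + 2)) (u k)
    have : 0 ≤ A * w + 2 ^ (α + 1) * A * w := by positivity
    linarith
  rw [hv]
  calc _ ≤ _ := (abs_sub _ _).trans (add_le_add h4 h3)
    _ = _ := by ring

end Recurrence

/-! ### The error at an interior singularity -/

section AtSingularity

/-- Sine coefficients over a full turn, up to normalization. -/
noncomputable def sineCoeff (G : ℝ → ℝ) (k : ℕ) : ℝ :=
  ∫ t in (0 : ℝ)..(2 * Real.pi), G t * Real.sin (k * t)

lemma sineCoeff_cos_sub_mul {G : ℝ → ℝ} (hG : Continuous G) (c : ℝ) (k : ℕ) :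
    sineCoeff (fun t => (Real.cos t - c) * G t) (k + 1) =
      (sineCoeff G (k + 2) + sineCoeff G k) / 2 - c * sineCoeff G (k + 1) := by
  have hi : ∀ k : ℕ, IntervalIntegrable (fun t => G t * Real.sin (k * t))
      MeasureTheory.volume 0 (2 * Real.pi) := fun k =>
    Continuous.intervalIntegrable (by fun_prop) _ _
  have e : ∀ t : ℝ, (Real.cos t - c) * G t * Real.sin ((k + 1 : ℕ) * t) =
      (G t * Real.sin ((k + 2 : ℕ) * t) + G t * Real.sin (k * t)) / 2 -
        c * (G t * Real.sin ((k + 1 : ℕ) * t)) := by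
    intro t
    have h1 : ((k + 2 : ℕ) : ℝ) * t = ((k + 1 : ℕ) : ℝ) * t + t := by push_cast; ring
    have h2 : (k : ℝ) * t = ((k + 1 : ℕ) : ℝ) * t - t := by push_cast; ring
    rw [h1, h2, Real.sin_add, Real.sin_sub]
    ring
  simp only [sineCoeff]
  simp_rw [e]
  rw [intervalIntegral.integral_sub (((hi _).add (hi k)).div_const 2) ((hi _).const_mul c),
    intervalIntegral.integral_const_mul, intervalIntegral.integral_div,
    intervalIntegral.integral_add (hi _) (hi k)]

/-- The factors `cos t - c` are removed one at a time. Once all `p` are present, the coefficients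
are one order smaller and the tail is summed directly. -/
lemma tailDecay_sineCoeff {α c : ℝ} (hα : 0 < α) (hc : c ≠ 1) {p : ℕ} {G : ℝ → ℝ}
    (hG : Continuous G) {A B : ℝ}
    (hA : ∀ k : ℕ, 1 ≤ k → |sineCoeff G k| ≤ A * (k : ℝ) ^ (-(α + 1)))
    (hB : ∀ k : ℕ, 1 ≤ k →
      |sineCoeff (fun t => (Real.cos t - c) ^ p * G t) k| ≤ B * (k : ℝ) ^ (-(α + 2))) :
    TailDecay α (sineCoeff G) := by
  induction p generalizing G A with
  | zero => exact tailDecay_of_abs_le hα (by simpa using hB)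
  | succ p ih =>
    have hrec := sineCoeff_cos_sub_mul hG c
    obtain ⟨A', hA'⟩ := abs_le_of_recurrence hα hA (by simp [sineCoeff]) hrec
    refine TailDecay.of_recurrence hα hc hA hrec (ih (by fun_prop) hA' ?_)
    simpa only [pow_succ, mul_assoc] using hB

/-- Shift each integral by `a` and expand `sin (k (θ - a))`; only the part with `cos (k θ)`
survives, since `f (cos θ)` is even. -/
lemma sineCoeff_reflected_difference {f : ℝ → ℝ} (hf : ContinuousOn f (Icc (-1) 1)) (a : ℝ)
    (k : ℕ) :
    sineCoeff (fun t => f (Real.cos (a + t)) - f (Real.cos (a - t))) k =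
      -(2 * Real.pi) * (chebCoeff f k * Real.sin (k * a)) := by
  have hc := continuous_comp_cos hf
  have h1 : ∀ b : ℝ, ∫ θ in b..(b + 2 * Real.pi), f (Real.cos θ) * Real.sin (k * (θ - a)) =
      -Real.pi * (chebCoeff f k * Real.sin (k * a)) := by
    intro b
    have e : ∀ θ : ℝ, f (Real.cos θ) * Real.sin (k * (θ - a)) =
        Real.cos (k * a) * (f (Real.cos θ) * Real.sin (k * θ)) -
          Real.sin (k * a) * (f (Real.cos θ) * Real.cos (k * θ)) := by
      intro θ
      rw [mul_sub, Real.sin_sub]; ring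
    simp_rw [e]
    rw [intervalIntegral.integral_sub, intervalIntegral.integral_const_mul,
      intervalIntegral.integral_const_mul, integral_period_comp_cos_mul_sin,
      integral_period_comp_cos_mul_cos hf]
    · ring
    · exact (continuous_const.mul (hc.mul (by fun_prop))).intervalIntegrable _ _
    · exact (continuous_const.mul (hc.mul (by fun_prop))).intervalIntegrable _ _
  have h2 : ∫ t in (0 : ℝ)..(2 * Real.pi), f (Real.cos (a + t)) * Real.sin (k * t) =
      -Real.pi * (chebCoeff f k * Real.sin (k * a)) := by
    have := intervalIntegral.integral_comp_add_left (a := 0) (b := 2 * Real.pi)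
      (fun θ => f (Real.cos θ) * Real.sin (k * (θ - a))) a
    simp only [add_sub_cancel_left, add_zero] at this
    rw [this, h1]
  have h3 : ∫ t in (0 : ℝ)..(2 * Real.pi), f (Real.cos (a - t)) * Real.sin (k * t) =
      Real.pi * (chebCoeff f k * Real.sin (k * a)) := by
    have := intervalIntegral.integral_comp_sub_left (a := 0) (b := 2 * Real.pi)
      (fun θ => f (Real.cos θ) * Real.sin (k * (θ - a))) a
    have h4 := h1 (a - 2 * Real.pi)
    rw [sub_add_cancel] at h4
    rw [sub_zero, h4] at this
    have e : ∀ t : ℝ, f (Real.cos (a - t)) * Real.sin (k * (a - t - a)) =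
        -(f (Real.cos (a - t)) * Real.sin (k * t)) := by
      intro t
      rw [show (k : ℝ) * (a - t - a) = -(k * t) by ring, Real.sin_neg]; ring
    simp_rw [e] at this
    rw [intervalIntegral.integral_neg] at this
    linarith
  have c1 : Continuous fun t => f (Real.cos (a + t)) := hc.comp (by fun_prop : Continuous (a + ·))
  have c2 : Continuous fun t => f (Real.cos (a - t)) := hc.comp (by fun_prop : Continuous (a - ·))
  simp only [sineCoeff, sub_mul]
  rw [intervalIntegral.integral_sub, h2, h3]
  · ring
  · exact (c1.mul (by fun_prop)).intervalIntegrable _ _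
  · exact (c2.mul (by fun_prop)).intervalIntegrable _ _

variable {ξ α : ℝ} {g : ℝ → ℝ}

/-- The regular factor of the model function around its singularity, multiplied by a power that
removes the reflected singularity. -/
noncomputable def regularFactor (a α : ℝ) (q : ℕ) (g : ℝ → ℝ) (t : ℝ) : ℝ :=
  (Real.sin (a + t / 2) ^ 2) ^ (α / 2 + q) * (2 * Real.sin (t / 2 - a)) ^ (2 * q) *
    g (Real.cos (a + t))

lemma contDiff_regularFactor {a : ℝ} {n q : ℕ} (hα : 0 ≤ α) (hnq : n ≤ q)
    (hg : ContDiffOn ℝ n g (Icc (-1) 1)) : ContDiff ℝ n (regularFactor a α q g) := by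
  have h1 : ContDiff ℝ n fun x : ℝ => x ^ (α / 2 + q) :=
    Real.contDiff_rpow_const_of_le (by
      have : (n : ℝ) ≤ q := by exact_mod_cast hnq
      linarith)
  have h2 : ContDiff ℝ n fun t : ℝ => (Real.sin (a + t / 2) ^ 2) ^ (α / 2 + q) :=
    h1.comp (by fun_prop : ContDiff ℝ n fun t : ℝ => Real.sin (a + t / 2) ^ 2)
  have h3 : ContDiff ℝ n fun t : ℝ => g (Real.cos (a + t)) :=
    (contDiff_comp_cos hg).comp (by fun_prop : ContDiff ℝ n fun t : ℝ => a + t)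
  exact (h2.mul (by fun_prop)).mul h3

lemma cos_sub_pow_mul_modelFun (hα : 0 < α) (a : ℝ) (q : ℕ) (g : ℝ → ℝ) (t : ℝ) :
    (Real.cos t - Real.cos (2 * a)) ^ (2 * q) * modelFun (Real.cos a) α g (Real.cos (a + t)) =
      |2 * Real.sin (t / 2)| ^ α * regularFactor a α q g t := by
  have e1 : Real.cos t - Real.cos (2 * a) =
      -(Real.sin (a + t / 2) * (2 * Real.sin (t / 2 - a))) := by
    rw [Real.cos_sub_cos]
    ring_nf
  have e2 : Real.cos (a + t) - Real.cos a = -(2 * Real.sin (t / 2) * Real.sin (a + t / 2)) := by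
    rw [Real.cos_sub_cos]
    ring_nf
  set y := Real.sin (a + t / 2) with hy
  -- An even power of `y` absorbs `|y| ^ α` into a power of the smooth function `y ^ 2`, with
  -- exponent at least `q`.
  have e3 : (y ^ 2) ^ (α / 2 + q) = |y| ^ α * y ^ (2 * q) := by
    rcases eq_or_ne y 0 with h | h
    · rw [h, abs_zero, Real.zero_rpow hα.ne', zero_pow two_ne_zero, Real.zero_rpow (by positivity),
        zero_mul]
    · rw [Real.rpow_add_natCast (by positivity), ← pow_mul, ← sq_abs, ← Real.rpow_natCast |y| 2,
        ← Real.rpow_mul (abs_nonneg y)]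
      congr 2
      push_cast
      ring
  rw [modelFun, regularFactor, e1, e2, abs_neg, abs_mul, Real.mul_rpow (abs_nonneg _) (abs_nonneg _),
    Even.neg_pow (even_two_mul q), mul_pow, e3]
  ring

/-- After multiplication the difference is `|2 sin (t / 2)| ^ α (R t - R (-t))` with `R` regular.
The bracket vanishes at the singularity, so the order over a full turn is `α + 1`. -/
lemma sineCoeff_regularized (hα : 1 < α) (hξ : ξ ∈ Ioo (-1 : ℝ) 1) {N : ℕ}
    (hN : α + 1 < N) (hg : ContDiffOn ℝ (N + 1 : ℕ) g (Icc (-1) 1)) :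
    ∃ B, ∀ k : ℕ, 1 ≤ k →
      |sineCoeff (fun t => (Real.cos t - Real.cos (2 * Real.arccos ξ)) ^ (2 * (N + 1)) *
        (modelFun ξ α g (Real.cos (Real.arccos ξ + t)) -
          modelFun ξ α g (Real.cos (Real.arccos ξ - t)))) k| ≤ B * (k : ℝ) ^ (-(α + 2)) := by
  have hπ := Real.pi_pos
  set a := Real.arccos ξ with ha
  have hca : Real.cos a = ξ := Real.cos_arccos hξ.1.le hξ.2.le
  rw [← hca]
  have hreg := contDiff_regularFactor (α := α) (a := a) (n := N + 1) (q := N + 1) (by linarith) le_rfl hg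
  set R := regularFactor a α (N + 1) g with hR
  set G : ℝ → ℝ := fun t => |2 * Real.sin (t / 2)| ^ α * (R t - R (-t)) with hG
  have e : (fun t => (Real.cos t - Real.cos (2 * a)) ^ (2 * (N + 1)) *
      (modelFun (Real.cos a) α g (Real.cos (a + t)) -
        modelFun (Real.cos a) α g (Real.cos (a - t)))) = G := by
    funext t
    have h1 := cos_sub_pow_mul_modelFun (α := α) (by linarith) a (N + 1) g t
    have h2 := cos_sub_pow_mul_modelFun (α := α) (by linarith) a (N + 1) g (-t)
    rw [Real.cos_neg, neg_div, Real.sin_neg, mul_neg, abs_neg, ← sub_eq_add_neg] at h2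
    rw [mul_sub, h1, h2, hG]
    ring
  rw [e]
  have hvan : ArcSymbol 0 (0 + 2 * Real.pi) (N + 1) 1 (fun t => R t - R (-t)) := by
    refine ArcSymbol.of_contDiff_of_vanish (hreg.sub (hreg.comp contDiff_neg)) (by simp) ?_
    -- At the far end, `R (2π) = R (-2π)`: the half-angle sines only change sign and enter through
    -- even powers.
    have s1 : Real.sin (a + (0 + 2 * Real.pi) / 2) = -Real.sin a := by
      rw [zero_add, mul_div_cancel_left₀ _ two_ne_zero, Real.sin_add_pi]
    have s2 : Real.sin (a + -(0 + 2 * Real.pi) / 2) = -Real.sin a := by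
      rw [zero_add, neg_div, mul_div_cancel_left₀ _ two_ne_zero, ← sub_eq_add_neg,
        Real.sin_sub_pi]
    have s3 : Real.sin ((0 + 2 * Real.pi) / 2 - a) = Real.sin a := by
      rw [zero_add, mul_div_cancel_left₀ _ two_ne_zero, Real.sin_pi_sub]
    have s4 : Real.sin (-(0 + 2 * Real.pi) / 2 - a) = Real.sin a := by
      rw [zero_add, neg_div, mul_div_cancel_left₀ _ two_ne_zero, ← neg_add', Real.sin_neg,
        add_comm, Real.sin_add_pi, neg_neg]
    have s5 : Real.cos (a + -(0 + 2 * Real.pi)) = Real.cos (a + (0 + 2 * Real.pi)) := by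
      rw [zero_add, ← sub_eq_add_neg, Real.cos_sub_two_pi, Real.cos_add_two_pi]
    simp only [hR, regularFactor, s1, s2, s3, s4, s5, sub_self]
  have hsin : ArcSymbol 0 (0 + 2 * Real.pi) (N + 1) α (fun t => |2 * Real.sin (t / 2)| ^ α) := by
    refine ((arcSymbol_sin_half_rpow 0 α (N + 1)).const_mul (2 ^ α)).congr fun t ht => ?_
    have p : 0 < Real.sin (t / 2) :=
      Real.sin_pos_of_pos_of_lt_pi (by linarith [ht.1]) (by linarith [ht.2])
    simp only [sub_zero]
    rw [abs_of_pos (by positivity), Real.mul_rpow (by norm_num) p.le]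
  have hcont : Continuous G := by
    refine Continuous.mul (Continuous.rpow_const (by fun_prop) fun _ => Or.inr (by linarith)) ?_
    exact hreg.continuous.sub (hreg.continuous.comp continuous_neg)
  obtain ⟨K, hK⟩ := ArcSymbol.abs_integral_mul_cos_le (by linarith) (hsin.mul hvan)
    (by push_cast; linarith) (by linarith) hcont
  refine ⟨K, fun k hk => ?_⟩
  -- The phase `-π / 2` turns the cosine into a sine.
  have := hK k (-(Real.pi / 2)) (by exact_mod_cast hk)
  simp only [← sub_eq_add_neg, Real.cos_sub_pi_div_two, zero_add] at this
  rw [show -(α + 1) - 1 = -(α + 2) by ring] at this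
  exact this

/-- Decay of the error at the interior singularity itself. -/
theorem abs_chebDiffError_singularity_le (hα : 1 < α) (hξ : ξ ∈ Ioo (-1 : ℝ) 1) {N : ℕ}
    (hN : α + 1 < N) (hg : ContDiffOn ℝ (N + 1 : ℕ) g (Icc (-1) 1)) :
    ∃ K, ∀ n : ℕ, 1 ≤ n → |chebDiffError (modelFun ξ α g) n ξ| ≤ K * (n : ℝ) ^ (-α) := by
  have hπ := Real.pi_pos
  have hf := contDiffOn_modelFun hα ξ (hg.of_le (by norm_cast; omega))
  set f := modelFun ξ α g with hfdef
  obtain ⟨⟨A, hA⟩, -⟩ := chebCoeff_modelFun_interior hα hξ hN hg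
  obtain ⟨B, hB⟩ := sineCoeff_regularized hα hξ hN hg
  have ha := arccos_mem_Ioo hξ
  set a := Real.arccos ξ with hadef
  have hca : Real.cos a = ξ := Real.cos_arccos hξ.1.le hξ.2.le
  have hsa : 0 < Real.sin a := Real.sin_pos_of_pos_of_lt_pi ha.1 ha.2
  -- The reflected singularity `2a` is distinct from `0` on the circle because `ξ ≠ ±1`.
  have hc1 : Real.cos (2 * a) ≠ 1 := by
    rw [Real.cos_two_mul']
    nlinarith [Real.sin_sq_add_cos_sq a]
  have hc := continuous_comp_cos hf.continuousOn
  have hG : Continuous fun t => f (Real.cos (a + t)) - f (Real.cos (a - t)) :=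
    (hc.comp (by fun_prop : Continuous (a + ·))).sub (hc.comp (by fun_prop : Continuous (a - ·)))
  have hS : ∀ k : ℕ, 1 ≤ k →
      |sineCoeff (fun t => f (Real.cos (a + t)) - f (Real.cos (a - t))) k| ≤
        2 * Real.pi * A * (k : ℝ) ^ (-(α + 1)) := by
    intro k hk
    rw [sineCoeff_reflected_difference hf.continuousOn, abs_mul, abs_neg,
      abs_of_pos Real.two_pi_pos, abs_mul, mul_assoc (2 * Real.pi)]
    refine mul_le_mul_of_nonneg_left ?_ Real.two_pi_pos.le
    exact (mul_le_of_le_one_right (abs_nonneg _) (Real.abs_sin_le_one _)).trans (hA k hk)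
  have htail := tailDecay_sineCoeff (by linarith) hc1 hG hS hB
  have hξ1 : |ξ| < 1 := abs_lt.2 hξ
  have hlim := tendsto_chebDiffError hf (r := (|ξ| + 1) / 2) (by linarith) zero_le_one
    (by linarith) hA (fun k y hy => abs_eval_derivative_T_le_mul k (by linarith) hy)
    (x := ξ) (abs_lt.1 (by linarith))
  set b := -(2 * Real.pi) * Real.sin a with hb
  have hb0 : 0 < |b| := abs_pos.2 (mul_ne_zero (neg_ne_zero.2 Real.two_pi_pos.ne') hsa.ne')
  have hstep : ∀ n, b * chebDiffError f n ξ - b * chebDiffError f (n + 1) ξ = ((n + 1 : ℕ) : ℝ) *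
      sineCoeff (fun t => f (Real.cos (a + t)) - f (Real.cos (a - t))) (n + 1) := by
    intro n
    have h1 := chebDiffError_sub_succ f n ξ
    have h2 := eval_derivative_T_cos_mul_sin (n + 1) a
    rw [hca] at h2
    rw [sineCoeff_reflected_difference hf.continuousOn, ← mul_sub, h1, hb]
    linear_combination (-(2 * Real.pi) * chebCoeff f (n + 1)) * h2
  obtain ⟨K, hK⟩ := htail (fun n => b * chebDiffError f n ξ) hstep
    (by simpa using hlim.const_mul b)
  refine ⟨K / |b|, fun n hn => ?_⟩
  have := hK n hn
  rw [abs_mul] at this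
  rw [div_mul_eq_mul_div, le_div_iff₀ hb0]
  linarith

end AtSingularity

/-! ### Assembly of the estimates -/

lemma isBigO_rpow_of_abs_le {E : ℕ → ℝ} {s : ℝ}
    (h : ∃ K, ∀ n : ℕ, 1 ≤ n → |E n| ≤ K * (n : ℝ) ^ s) :
    E =O[atTop] fun n : ℕ => (n : ℝ) ^ s := by
  obtain ⟨K, hK⟩ := h
  refine Asymptotics.IsBigO.of_bound K ?_
  filter_upwards [eventually_ge_atTop 1] with n hn
  rw [Real.norm_of_nonneg (Real.rpow_nonneg (Nat.cast_nonneg n) s)]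
  exact hK n hn

lemma abs_maxNorm_le {h : ℝ → ℝ} {B : ℝ} (hB : ∀ x ∈ Icc (-1 : ℝ) 1, |h x| ≤ B) :
    |maxNorm h| ≤ B := by
  have h0 : 0 ≤ B := (abs_nonneg _).trans (hB 0 (by simp))
  rw [maxNorm, abs_of_nonneg]
  · exact Real.sSup_le (by rintro _ ⟨x, hx, rfl⟩; exact hB x hx) h0
  · exact Real.sSup_nonneg (by rintro _ ⟨x, -, rfl⟩; exact abs_nonneg _)

theorem mainTheorem3 (α : ℝ) (hα : 1 < α) :
    ∃ m : ℕ,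
      (∀ ξ ∈ Ioo (-1 : ℝ) 1, (¬ ∃ j : ℤ, α = 2 * (j : ℝ)) →
        ∀ g : ℝ → ℝ, ContDiffOn ℝ m g (Icc (-1) 1) →
          ContDiffOn ℝ 1 (modelFun ξ α g) (Icc (-1) 1) ∧
          (∀ x ∈ Ioo (-1 : ℝ) 1,
            (fun n : ℕ => chebDiffError (modelFun ξ α g) n x)
              =O[atTop] fun n : ℕ => (n : ℝ) ^ (-α)) ∧
          (∀ x : ℝ, x = 1 ∨ x = -1 →
            (fun n : ℕ => chebDiffError (modelFun ξ α g) n x)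
              =O[atTop] fun n : ℕ => (n : ℝ) ^ (1 - α)) ∧
          (fun n : ℕ => maxNorm (chebDiffError (modelFun ξ α g) n))
            =O[atTop] fun n : ℕ => (n : ℝ) ^ (1 - α)) ∧
      (∀ ξ : ℝ, ξ = 1 ∨ ξ = -1 → (¬ ∃ j : ℤ, α = (j : ℝ)) →
        ∀ g : ℝ → ℝ, ContDiffOn ℝ m g (Icc (-1) 1) →
          ContDiffOn ℝ 1 (modelFun ξ α g) (Icc (-1) 1) ∧
          (∀ x ∈ Ioo (-1 : ℝ) 1,
            (fun n : ℕ => chebDiffError (modelFun ξ α g) n x)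
              =O[atTop] fun n : ℕ => (n : ℝ) ^ (-2 * α)) ∧
          (fun n : ℕ => chebDiffError (modelFun ξ α g) n (-ξ))
            =O[atTop] (fun n : ℕ => (n : ℝ) ^ (1 - 2 * α)) ∧
          (fun n : ℕ => chebDiffError (modelFun ξ α g) n ξ)
            =O[atTop] (fun n : ℕ => (n : ℝ) ^ (2 - 2 * α)) ∧
          (fun n : ℕ => maxNorm (chebDiffError (modelFun ξ α g) n))
            =O[atTop] fun n : ℕ => (n : ℝ) ^ (2 - 2 * α)) := by
  -- The strongest demand comes from `ξ = ±1`: there `(x - ξ) f` has order `2α + 1`, and its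
  -- integrals need more than `2α + 2` derivatives, supplied by `N + 1`.
  obtain ⟨N, hN⟩ := exists_nat_gt (2 * α + 1)
  refine ⟨N + 1, fun ξ hξ _ g hg => ?_, fun ξ hξ _ g hg => ?_⟩
  · have hf := contDiffOn_modelFun hα ξ (hg.of_le (by norm_cast; omega))
    have hN' : α + 1 < N := by linarith
    obtain ⟨⟨A, hA⟩, B, hB⟩ := chebCoeff_modelFun_interior hα hξ hN' hg
    obtain ⟨K, hK⟩ := abs_chebDiffError_le_uniform hf hα hξ hA hB
    refine ⟨hf, fun x hx => isBigO_rpow_of_abs_le ?_, fun x hx => isBigO_rpow_of_abs_le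
      ⟨K, fun n hn => hK n hn x ?_⟩, isBigO_rpow_of_abs_le
      ⟨K, fun n hn => abs_maxNorm_le (hK n hn)⟩⟩
    · rcases eq_or_ne x ξ with rfl | hxξ
      · exact abs_chebDiffError_singularity_le hα hξ hN' hg
      · exact abs_chebDiffError_le_of_ne hf hα hA hB hx hxξ
    · rcases hx with rfl | rfl <;> simp
  · have hf := contDiffOn_modelFun hα ξ (hg.of_le (by norm_cast; omega))
    obtain ⟨⟨A, hA⟩, B, hB⟩ := chebCoeff_modelFun_endpoint hα hξ hN hg
    have hρ : 1 < 2 * α := by linarith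
    have hξ1 : ξ ∈ Icc (-1 : ℝ) 1 := by rcases hξ with rfl | rfl <;> simp
    have hmax : ∀ n : ℕ, 1 ≤ n → ∀ x ∈ Icc (-1 : ℝ) 1,
        |chebDiffError (modelFun ξ α g) n x| ≤
          A / (2 * α + 1 - 3) * (n : ℝ) ^ (2 - 2 * α) := by
      intro n hn x hx
      have := abs_chebDiffError_le_of_mem_Icc hf (by linarith) hA hx hn
      rwa [show 3 - (2 * α + 1) = 2 - 2 * α by ring] at this
    refine ⟨hf, fun x hx => isBigO_rpow_of_abs_le ?_, isBigO_rpow_of_abs_le ?_,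
      isBigO_rpow_of_abs_le ⟨_, fun n hn => hmax n hn ξ hξ1⟩,
      isBigO_rpow_of_abs_le ⟨_, fun n hn => abs_maxNorm_le (hmax n hn)⟩⟩
    · rw [neg_mul]
      refine abs_chebDiffError_le_of_ne hf hρ hA hB hx ?_
      rintro rfl
      rcases hξ with rfl | rfl
      · exact lt_irrefl _ hx.2
      · exact lt_irrefl _ hx.1
    -- At the opposite endpoint `|x - ξ| = 2`, so the estimate for the product loses only a
    -- constant.
    · obtain ⟨K, hK⟩ := abs_sub_mul_chebDiffError_le_of_mem_Icc hf hρ hA hB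
      refine ⟨K / 2, fun n hn => ?_⟩
      have h := hK n hn (-ξ) ⟨by linarith [hξ1.2], by linarith [hξ1.1]⟩
      have h2 : |-ξ - ξ| = 2 := by rcases hξ with rfl | rfl <;> norm_num
      rw [abs_mul, h2] at h
      linarith
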